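/- Let $T>0$, let $\mathcal I=\{1,\dots,n\}$ be the decision-makers and $\mathcal S=\{1,\dots,m\}$ the regimes. Let $b_1(t,s)$, $b_{2j}(t,s)$, $q_i(t,s)$, $r_i(t,s)$ and $\tilde q_{ss'}(t)$ be real coefficients, bounded and measurable in $t\in[0,T]$, with $q_i\ge 0$, $r_i>\delta>0$ for a constant $\delta$, and $\tilde q_{ss'}>0$ for $s\ne s'$; let $x_0>e$. On a filtered probability space $(\Omega,\mathcal F,(\mathcal F_t),\mathbb P)$ let $s(\cdot)$ be an adapted $\mathcal S$-valued process with càdlàg paths and $$\mathbb P(s(t+\epsilon)=s'\mid\mathcal F_t)=\int_t^{t+\epsilon}\tilde q_{s(t)s'}(t')\,dt'+o(\epsilon)\quad\text{on }\{s(t)\neq s'\},$$ where $o(\epsilon)$ is uniform in $t$. A strategy of $j$ is a map $(t,\omega,x)\mapsto\gamma_j(t,\omega,x)$ which for each $t$ is $\mathcal F_t\otimes\mathcal B(\mathbb R)$-measurable in $(\omega,x)$ (this includes adapted processes and feedback laws in $(t,x,s(t))$). A profile $\gamma$ produces the positive, continuous, adapted state $x$ with $$dx=\Big(b_1\,x\ln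 x+\sum_{j\in\mathcal I}b_{2j}\,x\,u_j\Big)dt,\qquad x(0)=x_0,\qquad u_j(t)=\gamma_j(t,\cdot,x(t)),$$ where the coefficients are evaluated at $(t,s(t))$ and the controls are required to be adapted with $\mathbb E\int_0^Tu_j^2\,dt<\infty$. Decision-maker $i$ minimizes $\mathbb E[L_i]$, where $$L_i(x,u)=q_i(T,s(T))\ln^2 x(T)+\int_0^T\big(q_i\ln^2x+r_iu_i^2\big)dt .$$ Consider the coupled Riccati system with switching, for $t\in[0,T]$, $s\in\mathcal S$, $i\in\mathcal I$, $$\dot\alpha_i=-q_i-2b_1\alpha_i+2\alpha_i\sum_{j\ne i}\alpha_j\frac{b_{2j}^2}{r_j}+\alpha_i^2\frac{b_{2i}^2}{r_i}-\sum_{s'\in\mathcal S}[\alpha_i(t,s')-\alpha_i(t,s)]\tilde q_{ss'},\qquad \alpha_i(T,s)=q_i(T,s),$$ solutions being continuous on $[0,T]$ and satisfying the integrated equation. This system has a solution on $[0,T]$. For every solution $\alpha$, the feedback profile $$u_i^*=-\frac{\alpha_i(t,s(t))\,b_{2i}(t,s(t))}{r_i(t,s(t))}\,\ln x,\qquad i\in\mathcal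 I,$$ is a Nash equilibrium: it produces a state process, and no decision-maker $i$ can lower $\mathbb E[L_i]$ by changing only their own strategy. Along every state produced by $u^*$ the cost $L_i$ is integrable, and the equilibrium cost is $$\mathbb E[L_i(x,u^*)]=\mathbb E\big[\alpha_i(0,s(0))\ln^2x_0\big],$$ which is $\alpha_i(0,s_0)\ln^2x_0$ when $s(0)=s_0$ is deterministic. -/

import Mathlib

open MeasureTheory ProbabilityTheory Filter Topology

noncomputable section

/-- The data of a logarithm-square game with `n` decision-makers and `m` regimes: horizon `T`,
initial state `x₀`, drift coefficients `b₁(t,s)` and `b₂ⱼ(t,s)`, cost weights `qᵢ(t,s)` and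
`rᵢ(t,s)` (the terminal weight is `qᵢ(T,s)`), and switching rates `rate t s s'` from regime `s` to
regime `s' ≠ s`. Only times `t ∈ [0,T]` and off-diagonal rates are ever used. -/
structure LogSquareGame (n m : ℕ) where
  T : ℝ
  x₀ : ℝ
  b₁ : ℝ → Fin m → ℝ
  b₂ : Fin n → ℝ → Fin m → ℝ
  q : Fin n → ℝ → Fin m → ℝ
  r : Fin n → ℝ → Fin m → ℝ
  rate : ℝ → Fin m → Fin m → ℝ

/-- `f` is measurable and bounded on `[0,T]` (its values elsewhere do not matter). -/
def BddMeasurableOn (T : ℝ) (f : ℝ → ℝ) : Prop :=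
  Measurable ((Set.Icc 0 T).domRestrict f) ∧ ∃ C : ℝ, ∀ t ∈ Set.Icc 0 T, |f t| ≤ C

/-- `s` is a regime switching process on `[0,T]` with values in `{1, …, m}`, relative to the
filtration `ℱ`: it is adapted, has càdlàg (piecewise constant) paths, and jumps according to
`ℙ(s(t+ε) = s' | ℱ_t) = ∫_t^{t+ε} rate(t', s(t), s') dt' + o(ε)` for `s' ≠ s(t)`, where the `o(ε)`
is uniform in `t`. The initial regime `s(0)` may be random. -/
structure IsRegimeSwitching {Ω : Type*} {mΩ : MeasurableSpace Ω} {m : ℕ} (μ : Measure Ω)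
    (ℱ : Filtration ℝ mΩ) (T : ℝ) (rate : ℝ → Fin m → Fin m → ℝ) (s : ℝ → Ω → Fin m) :
    Prop where
  adapted : ∀ t ∈ Set.Icc 0 T, Measurable[ℱ t] (s t)
  right_continuous : ∀ ω, ∀ t ∈ Set.Ico 0 T, ∀ᶠ t' in 𝓝[>] t, s t' ω = s t ω
  left_limit : ∀ ω, ∀ t ∈ Set.Ioc 0 T, ∃ k, ∀ᶠ t' in 𝓝[<] t, s t' ω = k
  transition : ∃ ρ : ℝ → ℝ, ρ =o[𝓝[>] 0] (fun ε : ℝ => ε) ∧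
    ∀ t ε : ℝ, 0 ≤ t → 0 < ε → t + ε ≤ T → ∀ s' : Fin m, ∀ᵐ ω ∂μ, s t ω ≠ s' →
      |(μ[Set.indicator {ω' | s (t + ε) ω' = s'} (fun _ => (1 : ℝ)) | ℱ t]) ω
        - ∫ t' in t..(t + ε), rate t' (s t ω) s'| ≤ ρ ε

/-- A (non-anticipative, state-feedback) strategy `γ`: at time `t`, in scenario `ω` and state `x`,
the action is `γ t ω x`, which may use only the information in `ℱ_t` besides `x`. Both
`ℱ`-adapted processes (no dependence on `x`) and feedback laws `φ(t, x, s(t))` are of this form. -/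
def IsStrategy {Ω : Type*} {mΩ : MeasurableSpace Ω} (ℱ : Filtration ℝ mΩ) (T : ℝ)
    (γ : ℝ → Ω → ℝ → ℝ) : Prop :=
  ∀ t ∈ Set.Icc 0 T,
    Measurable[(ℱ t).prod (borel ℝ)] (fun p : Ω × ℝ => γ t p.1 p.2)

/-- Admissible control processes: `ℱ`-adapted with `𝔼 ∫_0^T u(t)² dt < ∞`. -/
structure IsAdmissibleControl {Ω : Type*} {mΩ : MeasurableSpace Ω} (μ : Measure Ω)
    (ℱ : Filtration ℝ mΩ) (T : ℝ) (u : ℝ → Ω → ℝ) : Prop where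
  adapted : ∀ t ∈ Set.Icc 0 T, Measurable[ℱ t] (u t)
  square_integrable : MemLp (fun p : ℝ × Ω => u p.1 p.2) 2
    ((volume.restrict (Set.Icc 0 T)).prod μ)

namespace LogSquareGame

variable {n m : ℕ} (G : LogSquareGame n m)

/-- All coefficients of the game are bounded measurable functions of time on `[0,T]`. -/
structure BddMeasurableCoeffs : Prop where
  b₁ : ∀ s, BddMeasurableOn G.T (fun t => G.b₁ t s)
  b₂ : ∀ j s, BddMeasurableOn G.T (fun t => G.b₂ j t s)
  q : ∀ i s, BddMeasurableOn G.T (fun t => G.q i t s)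
  r : ∀ i s, BddMeasurableOn G.T (fun t => G.r i t s)
  rate : ∀ s s', BddMeasurableOn G.T (fun t => G.rate t s s')

/-- The time derivative prescribed by the coupled Riccati system for `αᵢ(t,s)`. -/
def riccatiRHS (α : Fin n → ℝ → Fin m → ℝ) (i : Fin n) (t : ℝ) (s : Fin m) : ℝ :=
  - G.q i t s - 2 * G.b₁ t s * α i t s
    + 2 * α i t s * ∑ j ∈ Finset.univ.erase i, α j t s * (G.b₂ j t s ^ 2 / G.r j t s)
    + α i t s ^ 2 * (G.b₂ i t s ^ 2 / G.r i t s)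
    - ∑ s' : Fin m, (α i t s' - α i t s) * G.rate t s s'

/-- `α` solves the Riccati system on `[0,T]` with `αᵢ(T,s) = qᵢ(T,s)`. The coefficients being
merely bounded and measurable in time, the equation is meant in the usual (Carathéodory) sense: `α`
is continuous and is the integral of the right-hand side. -/
def IsRiccatiSolution (α : Fin n → ℝ → Fin m → ℝ) : Prop :=
  ∀ i s, ContinuousOn (fun t => α i t s) (Set.Icc 0 G.T) ∧
    ∀ t ∈ Set.Icc 0 G.T, α i t s = G.q i G.T s - ∫ t' in t..G.T, G.riccatiRHS α i t' s

variable {Ω : Type*} {mΩ : MeasurableSpace Ω} (μ : Measure Ω) (ℱ : Filtration ℝ mΩ)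
  (s : ℝ → Ω → Fin m)

/-- The control of decision-maker `j` that results from the profile `γ` along the state `x`. -/
def control (γ : Fin n → ℝ → Ω → ℝ → ℝ) (x : ℝ → Ω → ℝ) (j : Fin n) (t : ℝ) (ω : Ω) : ℝ :=
  γ j t ω (x t ω)

/-- `x` is a state process produced by the strategy profile `γ`: the resulting controls are
admissible, and `x` is an adapted, continuous, positive solution of
`dx = (b₁ x ln x + ∑ⱼ b₂ⱼ x uⱼ) dt`, `x(0) = x₀`. -/
structure IsState (γ : Fin n → ℝ → Ω → ℝ → ℝ) (x : ℝ → Ω → ℝ) : Prop where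
  admissible : ∀ j, IsAdmissibleControl μ ℱ G.T (control γ x j)
  adapted : ∀ t ∈ Set.Icc 0 G.T, Measurable[ℱ t] (x t)
  continuous : ∀ᵐ ω ∂μ, ContinuousOn (fun t => x t ω) (Set.Icc 0 G.T)
  positive : ∀ᵐ ω ∂μ, ∀ t ∈ Set.Icc 0 G.T, 0 < x t ω
  dynamics : ∀ᵐ ω ∂μ, ∀ t ∈ Set.Icc 0 G.T,
    x t ω = G.x₀ + ∫ t' in (0 : ℝ)..t,
      (G.b₁ t' (s t' ω) * x t' ω * Real.log (x t' ω)
        + ∑ j, G.b₂ j t' (s t' ω) * x t' ω * control γ x j t' ω)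

/-- The random cost `Lᵢ(x,u) = qᵢ(T,s(T)) ln²(x(T)) + ∫_0^T (qᵢ ln²(x) + rᵢ uᵢ²) dt`. -/
def cost (i : Fin n) (x u : ℝ → Ω → ℝ) (ω : Ω) : ℝ :=
  G.q i G.T (s G.T ω) * Real.log (x G.T ω) ^ 2
    + ∫ t in (0 : ℝ)..G.T,
      (G.q i t (s t ω) * Real.log (x t ω) ^ 2 + G.r i t (s t ω) * u t ω ^ 2)

/-- `γ` is a Nash equilibrium: it consists of strategies, it produces a state process, and no
decision-maker `i` can lower the expected cost `𝔼[Lᵢ]` by switching unilaterally to another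
strategy `v` while the others keep theirs. -/
def IsNashEquilibrium (γ : Fin n → ℝ → Ω → ℝ → ℝ) : Prop :=
  (∀ i, IsStrategy ℱ G.T (γ i)) ∧
  (∃ x, G.IsState μ ℱ s γ x) ∧
  ∀ x, G.IsState μ ℱ s γ x →
    ∀ (i : Fin n) (v : ℝ → Ω → ℝ → ℝ), IsStrategy ℱ G.T v →
      ∀ x', G.IsState μ ℱ s (Function.update γ i v) x' →
        ∫ ω, G.cost s i x (control γ x i) ω ∂μ
          ≤ ∫ ω, G.cost s i x' (control (Function.update γ i v) x' i) ω ∂μ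

/-- The candidate profile `uᵢ* = -(αᵢ(t,s(t)) b₂ᵢ(t,s(t)) / rᵢ(t,s(t))) ln x`. -/
def feedback (α : Fin n → ℝ → Fin m → ℝ) (i : Fin n) (t : ℝ) (ω : Ω) (x : ℝ) : ℝ :=
  -(α i t (s t ω) * G.b₂ i t (s t ω) / G.r i t (s t ω)) * Real.log x

end LogSquareGame

end

/-! In the coordinate `y = ln x` the dynamics become linear, `dy = (b₁ y + ∑ⱼ b₂ⱼ uⱼ) dt`, and the
costs quadratic, so the game is linear-quadratic with switching coefficients. Noise enters only
through the regime; given a regime path and the controls, `y` is absolutely continuous.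

Let the players `j ≠ i` use the feedback and let player `i` use anything. Expand `αᵢ(t, s(t)) y²`
along the path: the Riccati equation is what makes the running cost equal to `rᵢ (uᵢ - uᵢ*)²` minus
the generator of this product, `uᵢ*` being the feedback evaluated along the same state. Dynkin's
formula (`integral_dynkin`) integrates the generator to a difference of boundary values, and the
terminal value is the terminal cost. Hence `𝔼[Lᵢ] = 𝔼[αᵢ(0,s(0)) ln² x₀] + 𝔼 ∫ rᵢ (uᵢ - uᵢ*)² dt`
(`IsState.integral_cost`). The last term is nonnegative and vanishes when `i` also uses the
feedback: this gives the equilibrium and its value together.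

Dynkin's formula is proved directly from the infinitesimal transition law. On a grid with `N + 1`
cells, each increment of the product is replaced by its compensator, at a cost in expectation of
`o(T/(N+1))` per cell; the sum of compensators converges pathwise under an integrable bound. The
bound on `ln² x` comes from Grönwall's inequality and the square integrability of the controls.

For existence of `α` (`exists_isRiccatiSolution`), the unknowns are clipped to `[0, M(t)]`, which
makes the quadratic field globally Lipschitz, and a contraction solves the clipped system. The signs
of `q`, `r` and the off-diagonal rates make `0` and `M` barriers, so the clipping is never active.
The state under the feedback profile is explicit: `ln x` is `ln x₀` times the exponential of an
integral. -/

/-! ### Chain rule and Grönwall inequality for absolutely continuous paths. -/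

/-- A Lipschitz function of an absolutely continuous one is absolutely continuous, hence the
integral of its a.e. derivative, which the pointwise chain rule identifies. Here `h` is only
integrable, so the classical fundamental theorem does not apply. -/
theorem comp_eq_add_integral {φ φ' y h : ℝ → ℝ} {a b K : ℝ} {S : Set ℝ} (hab : a ≤ b)
    (hS : Convex ℝ S) (hφ : ∀ x ∈ S, HasDerivAt φ (φ' x) x) (hK : ∀ x ∈ S, |φ' x| ≤ K)
    (hyS : ∀ t ∈ Set.Icc a b, y t ∈ S) (hh : IntervalIntegrable h volume a b)
    (hy : ∀ t ∈ Set.Icc a b, y t = y a + ∫ τ in a..t, h τ) :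
    ∀ t ∈ Set.Icc a b, φ (y t) = φ (y a) + ∫ τ in a..t, φ' (y τ) * h τ := by
  intro t ht
  have hat : Set.uIcc a t ⊆ Set.uIcc a b := by
    rw [Set.uIcc_of_le ht.1, Set.uIcc_of_le hab]; exact Set.Icc_subset_Icc_right ht.2
  -- `y` is controlled only on `[a,b]`; its primitive `I` is given by one formula everywhere, so
  -- two-sided derivatives make sense.
  set I : ℝ → ℝ := fun τ => y a + ∫ σ in a..τ, h σ with hI
  have hIy : ∀ τ ∈ Set.Icc a b, I τ = y τ := fun τ hτ => (hy τ hτ).symm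
  have hIac : AbsolutelyContinuousOnInterval I a b := by
    have h1 := hh.absolutelyContinuousOnInterval_intervalIntegral (c := a) (by simp)
    have h2 : AbsolutelyContinuousOnInterval (fun _ : ℝ => y a) a b :=
      (LipschitzWith.const (y a)).lipschitzOnWith.absolutelyContinuousOnInterval (K := 0)
    exact h2.fun_add h1
  have hK0 : 0 ≤ K := (abs_nonneg _).trans (hK (y a) (hyS a ⟨le_rfl, hab⟩))
  have hlip : LipschitzOnWith K.toNNReal φ S := by
    refine hS.lipschitzOnWith_of_nnnorm_hasDerivWithin_le (f' := φ')
      (fun x hx => (hφ x hx).hasDerivWithinAt) fun x hx => ?_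
    rw [← NNReal.coe_le_coe, coe_nnnorm, Real.norm_eq_abs, Real.coe_toNNReal _ hK0]
    exact hK x hx
  have hac : AbsolutelyContinuousOnInterval (fun τ => φ (I τ)) a b := by
    rw [absolutelyContinuousOnInterval_iff] at hIac ⊢
    intro ε hε
    -- `K + 1` rather than `K`, since `K` may be zero.
    obtain ⟨δ, hδ, H⟩ := hIac (ε / (K + 1)) (by positivity)
    refine ⟨δ, hδ, fun E hE hEδ => ?_⟩
    calc _ ≤ ∑ i ∈ Finset.range E.1, K * dist (I (E.2 i).1) (I (E.2 i).2) := by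
            refine Finset.sum_le_sum fun i hi => ?_
            obtain ⟨h1, h2⟩ := hE.1 i hi
            rw [Set.uIcc_of_le hab] at h1 h2
            have := hlip.dist_le_mul (I (E.2 i).1) (by rw [hIy _ h1]; exact hyS _ h1)
              (I (E.2 i).2) (by rw [hIy _ h2]; exact hyS _ h2)
            rwa [Real.coe_toNNReal _ hK0] at this
      _ = K * ∑ i ∈ Finset.range E.1, dist (I (E.2 i).1) (I (E.2 i).2) := by
            rw [Finset.mul_sum]
      _ ≤ K * (ε / (K + 1)) := by gcongr; exact (H E hE hEδ).le
      _ < (K + 1) * (ε / (K + 1)) := by gcongr; linarith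
      _ = ε := by field_simp
  have key := (hac.mono hat).integral_deriv_eq_sub
  have hcongr : ∫ τ in a..t, deriv (fun τ => φ (I τ)) τ = ∫ τ in a..t, φ' (y τ) * h τ := by
    refine intervalIntegral.integral_congr_ae ?_
    filter_upwards [hh.ae_hasDerivAt_integral] with τ hτ hτt
    have hτb : τ ∈ Set.uIcc a b := hat (Set.uIoc_subset_uIcc hτt)
    have h1 : HasDerivAt I (h τ) τ := (hτ hτb a (by simp)).const_add _
    rw [Set.uIcc_of_le hab] at hτb
    have h2 := hφ (I τ) (by rw [hIy _ hτb]; exact hyS _ hτb)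
    rw [hIy _ hτb] at h2
    rw [← hIy _ hτb] at h2
    have := (h2.comp τ h1).deriv
    rw [← hIy _ hτb]
    exact this
  rw [hcongr] at key
  have e1 : I t = y t := hIy t ht
  have e2 : I a = y a := hIy a ⟨le_rfl, hab⟩
  simp only [e1, e2] at key
  linarith

/-- Grönwall by an integrating factor: the a.e. derivative of `exp (-K t) v` is at most `exp (-K t)
w ≤ w`. The product rule is the one for absolutely continuous functions. -/
theorem le_exp_mul_of_integral_le {v h w : ℝ → ℝ} {T K : ℝ} (hT : 0 ≤ T) (hK : 0 ≤ K)
    (hh : IntervalIntegrable h volume 0 T) (hw : IntervalIntegrable w volume 0 T)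
    (hw0 : ∀ t ∈ Set.Icc 0 T, 0 ≤ w t) (hv0 : 0 ≤ v 0)
    (hv : ∀ t ∈ Set.Icc 0 T, v t = v 0 + ∫ τ in (0 : ℝ)..t, h τ)
    (hle : ∀ t ∈ Set.Icc 0 T, h t ≤ K * v t + w t) :
    ∀ t ∈ Set.Icc 0 T, v t ≤ Real.exp (K * T) * (v 0 + ∫ τ in (0 : ℝ)..T, w τ) := by
  intro t ht
  have hat : Set.uIcc 0 t ⊆ Set.uIcc 0 T := by
    rw [Set.uIcc_of_le ht.1, Set.uIcc_of_le hT]; exact Set.Icc_subset_Icc_right ht.2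
  have hht := hh.mono_set hat
  have hwt := hw.mono_set hat
  set I : ℝ → ℝ := fun τ => v 0 + ∫ σ in (0 : ℝ)..τ, h σ with hI
  have hIac : AbsolutelyContinuousOnInterval I 0 t := by
    have h1 := hht.absolutelyContinuousOnInterval_intervalIntegral (c := 0) (by simp)
    have h2 : AbsolutelyContinuousOnInterval (fun _ : ℝ => v 0) 0 t :=
      (LipschitzWith.const (v 0)).lipschitzOnWith.absolutelyContinuousOnInterval (K := 0)
    exact h2.fun_add h1
  have hder : ∀ τ, HasDerivAt (fun τ => Real.exp (-K * τ)) (Real.exp (-K * τ) * -K) τ := fun τ => by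
    simpa using ((hasDerivAt_id τ).const_mul (-K)).exp
  have hE : AbsolutelyContinuousOnInterval (fun τ => Real.exp (-K * τ)) 0 t :=
    ContDiffOn.absolutelyContinuousOnInterval (by fun_prop)
  have key := hE.integral_deriv_mul_eq_sub hIac
  have hcongr : ∫ τ in (0 : ℝ)..t, deriv (fun τ => Real.exp (-K * τ)) τ * I τ
        + Real.exp (-K * τ) * deriv I τ
      = ∫ τ in (0 : ℝ)..t, Real.exp (-K * τ) * (h τ - K * I τ) := by
    refine intervalIntegral.integral_congr_ae ?_
    filter_upwards [hht.ae_hasDerivAt_integral] with τ hτ hτt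
    have h1 : HasDerivAt I (h τ) τ :=
      (hτ (Set.uIoc_subset_uIcc hτt) 0 (by simp)).const_add _
    rw [(hder τ).deriv, h1.deriv]; ring
  rw [hcongr] at key
  have hIc : ContinuousOn I (Set.uIcc 0 t) := hIac.continuousOn
  have hle2 : ∫ τ in (0 : ℝ)..t, Real.exp (-K * τ) * (h τ - K * I τ) ≤ ∫ τ in (0 : ℝ)..t, w τ := by
    refine intervalIntegral.integral_mono_on ht.1 ?_ hwt fun τ hτ => ?_
    · refine IntervalIntegrable.continuousOn_mul (hht.sub ?_) (by fun_prop)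
      exact (hIc.const_smul K).intervalIntegrable
    · have hτT : τ ∈ Set.Icc 0 T := ⟨hτ.1, hτ.2.trans ht.2⟩
      have h1 := hle τ hτT
      have h2 : I τ = v τ := (hv τ hτT).symm
      have h3 : Real.exp (-K * τ) ≤ 1 := Real.exp_le_one_iff.2 (by nlinarith [hτ.1])
      have h4 := hw0 τ hτT
      have h5 := Real.exp_pos (-K * τ)
      rw [h2]
      calc _ ≤ Real.exp (-K * τ) * w τ := by gcongr; linarith
        _ ≤ 1 * w τ := by gcongr
        _ = w τ := one_mul _
  have hwT : ∫ τ in (0 : ℝ)..t, w τ ≤ ∫ τ in (0 : ℝ)..T, w τ := by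
    have := intervalIntegral.integral_add_adjacent_intervals hwt
      (hw.mono_set (a := 0) (b := T) (c := t) (d := T) (by
        rw [Set.uIcc_of_le ht.2, Set.uIcc_of_le hT]; exact Set.Icc_subset_Icc_left ht.1))
    have h0 : 0 ≤ ∫ τ in t..T, w τ := intervalIntegral.integral_nonneg ht.2 fun τ hτ =>
      hw0 τ ⟨ht.1.trans hτ.1, hτ.2⟩
    linarith
  have e1 : I t = v t := (hv t ht).symm
  have e2 : I 0 = v 0 := by simp [hI]
  have hW0 : 0 ≤ ∫ τ in (0 : ℝ)..T, w τ := intervalIntegral.integral_nonneg hT hw0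
  rw [e1, e2] at key
  simp only [mul_zero, Real.exp_zero, one_mul] at key
  have h6 : Real.exp (-K * t) * v t ≤ v 0 + ∫ τ in (0 : ℝ)..T, w τ := by linarith
  have h7 : v t = Real.exp (K * t) * (Real.exp (-K * t) * v t) := by
    rw [← mul_assoc, ← Real.exp_add]; simp
  rw [h7]
  calc _ ≤ Real.exp (K * t) * (v 0 + ∫ τ in (0 : ℝ)..T, w τ) := by gcongr
    _ ≤ _ := by
      have := ht.2
      gcongr

/-! ### Uniform grids and Riemann-type sums. -/

/-- The `l`-th point of the partition of `[0,T]` into `N + 1` intervals of equal length. -/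
noncomputable def gridPoint (T : ℝ) (N l : ℕ) : ℝ := T * l / (N + 1)

theorem gridPoint_zero (T : ℝ) (N : ℕ) : gridPoint T N 0 = 0 := by simp [gridPoint]

theorem gridPoint_last (T : ℝ) (N : ℕ) : gridPoint T N (N + 1) = T := by
  unfold gridPoint; push_cast; field_simp

theorem gridPoint_succ (T : ℝ) (N l : ℕ) :
    gridPoint T N (l + 1) = gridPoint T N l + T / (N + 1) := by
  unfold gridPoint; push_cast; ring

theorem gridPoint_mono {T : ℝ} (hT : 0 ≤ T) (N : ℕ) : Monotone (gridPoint T N) :=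
  monotone_nat_of_le_succ fun l => by
    rw [gridPoint_succ]; have : 0 ≤ T / (N + 1) := by positivity
    linarith

theorem gridPoint_mem {T : ℝ} (hT : 0 ≤ T) {N l : ℕ} (hl : l ≤ N + 1) :
    gridPoint T N l ∈ Set.Icc 0 T :=
  ⟨gridPoint_zero T N ▸ gridPoint_mono hT N l.zero_le,
    (gridPoint_mono hT N hl).trans_eq (gridPoint_last T N)⟩

/-- The index of the interval of the partition that contains `t`. -/
noncomputable def gridIndex (T : ℝ) (N : ℕ) (t : ℝ) : ℕ := ⌊t * (N + 1) / T⌋₊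

theorem gridIndex_spec {T : ℝ} (hT : 0 < T) (N : ℕ) {t : ℝ} (ht : 0 ≤ t) :
    gridPoint T N (gridIndex T N t) ≤ t ∧ t < gridPoint T N (gridIndex T N t + 1) := by
  unfold gridPoint gridIndex
  have hN : (0 : ℝ) < N + 1 := by positivity
  have h1 := Nat.floor_le (show 0 ≤ t * (N + 1) / T by positivity)
  have h2 := Nat.lt_floor_add_one (t * (N + 1) / T)
  rw [le_div_iff₀ hT] at h1
  rw [div_lt_iff₀ hT] at h2
  rw [div_le_iff₀ hN, lt_div_iff₀ hN]
  push_cast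
  constructor <;> linarith

theorem gridIndex_eq {T : ℝ} (hT : 0 < T) {N l : ℕ} {t : ℝ} (h1 : gridPoint T N l ≤ t)
    (h2 : t < gridPoint T N (l + 1)) : gridIndex T N t = l := by
  have ht : 0 ≤ t := (by unfold gridPoint; positivity : 0 ≤ gridPoint T N l).trans h1
  obtain ⟨h3, h4⟩ := gridIndex_spec hT N ht
  have hm := gridPoint_mono hT.le N
  by_contra hne
  rcases lt_or_gt_of_ne hne with h | h
  · exact absurd (hm (Nat.succ_le_of_lt h)) (by simp only [Nat.succ_eq_add_one]; linarith)
  · exact absurd (hm (Nat.succ_le_of_lt h)) (by simp only [Nat.succ_eq_add_one]; linarith)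

theorem gridIndex_lt {T : ℝ} (hT : 0 < T) (N : ℕ) {t : ℝ} (ht : 0 ≤ t) (htT : t < T) :
    gridIndex T N t < N + 1 := by
  by_contra h
  have := gridPoint_mono hT.le N (not_lt.1 h)
  rw [gridPoint_last] at this
  linarith [(gridIndex_spec hT N ht).1]

theorem tendsto_gridPoint_gridIndex {T : ℝ} (hT : 0 < T) {t : ℝ} (ht : 0 ≤ t) :
    Tendsto (fun N => gridPoint T N (gridIndex T N t)) atTop (𝓝 t) ∧
    Tendsto (fun N => gridPoint T N (gridIndex T N t + 1)) atTop (𝓝[>] t) := by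
  have hlim : Tendsto (fun N : ℕ => T / ((N : ℝ) + 1)) atTop (𝓝 0) :=
    tendsto_const_nhds.div_atTop (tendsto_atTop_add_const_right _ _ tendsto_natCast_atTop_atTop)
  constructor
  · refine tendsto_of_tendsto_of_tendsto_of_le_of_le (g := fun N : ℕ => t - T / (N + 1))
      (h := fun _ => t) ?_ tendsto_const_nhds (fun N => ?_) (fun N => (gridIndex_spec hT N ht).1)
    · simpa using tendsto_const_nhds.sub hlim
    · have := (gridIndex_spec hT N ht).2
      rw [gridPoint_succ] at this
      simp only; linarith
  · refine tendsto_nhdsWithin_iff.2 ⟨?_, Eventually.of_forall fun N => (gridIndex_spec hT N ht).2⟩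
    refine tendsto_of_tendsto_of_tendsto_of_le_of_le (g := fun _ => t)
      (h := fun N : ℕ => t + T / (N + 1)) tendsto_const_nhds ?_
      (fun N => (gridIndex_spec hT N ht).2.le) (fun N => ?_)
    · simpa using tendsto_const_nhds.add hlim
    · have := (gridIndex_spec hT N ht).1
      simp only [gridPoint_succ]; linarith

/-- The sum is the integral of a single function, obtained by freezing the first two arguments of
`H` at the ends of the cell around `t`. Both ends tend to `t`, so dominated convergence applies. -/
theorem tendsto_sum_integral_gridPoint {T : ℝ} (hT : 0 < T) {H : ℝ → ℝ → ℝ → ℝ}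
    {L bound : ℝ → ℝ} (hb : IntervalIntegrable bound volume 0 T)
    (hmeas : ∀ a ∈ Set.Icc 0 T, ∀ b ∈ Set.Icc 0 T, IntervalIntegrable (H a b) volume 0 T)
    (hle : ∀ a b t, 0 ≤ a → a ≤ t → t ≤ b → b ≤ T → |H a b t| ≤ bound t)
    (hlim : ∀ᵐ t, t ∈ Set.Ioo 0 T →
      Tendsto (fun p : ℝ × ℝ => H p.1 p.2 t) (𝓝 t ×ˢ 𝓝 t) (𝓝 (L t))) :
    IntervalIntegrable L volume 0 T ∧
    Tendsto (fun N : ℕ => ∑ l ∈ Finset.range (N + 1),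
      ∫ t in gridPoint T N l..gridPoint T N (l + 1), H (gridPoint T N l) (gridPoint T N (l + 1)) t)
      atTop (𝓝 (∫ t in (0 : ℝ)..T, L t)) := by
  set F : ℕ → ℝ → ℝ := fun N t =>
    H (gridPoint T N (gridIndex T N t)) (gridPoint T N (gridIndex T N t + 1)) t with hF
  have hmem : ∀ {N l}, l < N + 1 → gridPoint T N l ∈ Set.Icc 0 T ∧
      gridPoint T N (l + 1) ∈ Set.Icc 0 T := fun h =>
    ⟨gridPoint_mem hT.le h.le, gridPoint_mem hT.le h⟩
  -- `gridIndex` uses cells closed on the left, interval integrals use cells closed on the right;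
  -- the mismatch is a null set.
  have hne : ∀ c : ℝ, ∀ᵐ t : ℝ, t ≠ c := fun c => by simp [ae_iff, measure_singleton]
  have hpiece : ∀ N l, l < N + 1 → ∀ᵐ t, t ∈ Set.uIoc (gridPoint T N l) (gridPoint T N (l + 1)) →
      F N t = H (gridPoint T N l) (gridPoint T N (l + 1)) t := by
    intro N l hl
    filter_upwards [hne (gridPoint T N (l + 1))] with t ht htm
    rw [Set.uIoc_of_le (gridPoint_mono hT.le N l.le_succ)] at htm
    simp only [hF]
    rw [gridIndex_eq hT htm.1.le (lt_of_le_of_ne htm.2 ht)]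
  have hint : ∀ N l, l < N + 1 →
      IntervalIntegrable (F N) volume (gridPoint T N l) (gridPoint T N (l + 1)) := by
    intro N l hl
    have h1 : IntervalIntegrable (H (gridPoint T N l) (gridPoint T N (l + 1))) volume
        (gridPoint T N l) (gridPoint T N (l + 1)) := by
      refine (hmeas _ (hmem hl).1 _ (hmem hl).2).mono_set ?_
      rw [Set.uIcc_of_le (gridPoint_mono hT.le N l.le_succ), Set.uIcc_of_le hT.le]
      exact Set.Icc_subset_Icc (hmem hl).1.1 (hmem hl).2.2
    refine h1.congr_ae ?_
    rw [EventuallyEq, ae_restrict_iff' measurableSet_uIoc]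
    filter_upwards [hpiece N l hl] with t ht h using (ht h).symm
  have hintT : ∀ N, IntervalIntegrable (F N) volume 0 T := by
    intro N
    have := IntervalIntegrable.trans_iterate (a := gridPoint T N) (n := N + 1) (hint N)
    rwa [gridPoint_zero, gridPoint_last] at this
  have hsum : ∀ N, ∑ l ∈ Finset.range (N + 1),
      ∫ t in gridPoint T N l..gridPoint T N (l + 1), H (gridPoint T N l) (gridPoint T N (l + 1)) t
      = ∫ t in (0 : ℝ)..T, F N t := by
    intro N
    have := intervalIntegral.sum_integral_adjacent_intervals (a := gridPoint T N) (n := N + 1)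
      (hint N)
    rw [gridPoint_zero, gridPoint_last] at this
    rw [← this]
    refine Finset.sum_congr rfl fun l hl => intervalIntegral.integral_congr_ae ?_
    filter_upwards [hpiece N l (Finset.mem_range.1 hl)] with t ht h using (ht h).symm
  have hFle : ∀ᵐ t, t ∈ Set.uIoc 0 T → ∀ N, ‖F N t‖ ≤ bound t := by
    filter_upwards [hne T] with t ht htm N
    rw [Set.uIoc_of_le hT.le] at htm
    have hlt := gridIndex_lt hT N htm.1.le (lt_of_le_of_ne htm.2 ht)
    obtain ⟨h1, h2⟩ := gridIndex_spec hT N htm.1.le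
    exact hle _ _ _ (hmem hlt).1.1 h1 h2.le (hmem hlt).2.2
  have hFlim : ∀ᵐ t, t ∈ Set.uIoc 0 T → Tendsto (fun N => F N t) atTop (𝓝 (L t)) := by
    filter_upwards [hne T, hlim] with t ht hl htm
    rw [Set.uIoc_of_le hT.le] at htm
    obtain ⟨h1, h2⟩ := tendsto_gridPoint_gridIndex hT htm.1.le
    exact (hl ⟨htm.1, lt_of_le_of_ne htm.2 ht⟩).comp
      (h1.prodMk (h2.mono_right nhdsWithin_le_nhds))
  constructor
  · rw [intervalIntegrable_iff] at hb ⊢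
    refine Integrable.mono' hb (aestronglyMeasurable_of_tendsto_ae atTop
      (fun N => (intervalIntegrable_iff.1 (hintT N)).aestronglyMeasurable)
      ((ae_restrict_iff' measurableSet_uIoc).2 hFlim)) ?_
    rw [ae_restrict_iff' measurableSet_uIoc]
    filter_upwards [hFle, hFlim] with t h1 h2 ht
    exact le_of_tendsto (h2 ht).norm (Eventually.of_forall (h1 ht))
  · simp_rw [hsum]
    refine intervalIntegral.tendsto_integral_filter_of_dominated_convergence bound
      (Eventually.of_forall fun N => (intervalIntegrable_iff.1 (hintT N)).aestronglyMeasurable)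
      (Eventually.of_forall fun N => ?_) hb hFlim
    filter_upwards [hFle] with t h ht using h ht N

/-! ### Regularity of paths and joint measurability. -/

/-- Just to the left of any point `σ` is constant, so there are no bad points there: every bad point
is isolated from the left within the bad set. Such a set is countable, hence null. -/
theorem ae_eventually_eq_of_left_limit {E : Type*} {T : ℝ} {σ : ℝ → E}
    (hσ : ∀ t ∈ Set.Ioc 0 T, ∃ k, ∀ᶠ t' in 𝓝[<] t, σ t' = k) :
    ∀ᵐ t : ℝ, t ∈ Set.Ioo 0 T → ∀ᶠ t' in 𝓝 t, σ t' = σ t := by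
  set B : Set ℝ := {t | t ∈ Set.Ioo 0 T ∧ ¬ ∀ᶠ t' in 𝓝 t, σ t' = σ t} with hB
  have hcount : B.Countable := by
    refine (countable_setOfPred_isolated_left_within (s := B)).mono fun t ht => ?_
    refine Set.mem_ofPred_eq ▸ And.intro ht ?_
    obtain ⟨k, hk⟩ := hσ t ⟨ht.1.1, ht.1.2.le⟩
    rw [← Filter.empty_mem_iff_bot, Set.inter_comm, nhdsWithin_inter']
    have h1 : ∀ᶠ t' in 𝓝[<] t, t' ∉ B := by
      filter_upwards [eventually_eventually_nhdsWithin.2 hk, self_mem_nhdsWithin] with t' h1 h2 h3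
      rw [IsOpen.nhdsWithin_eq isOpen_Iio h2] at h1
      refine h3.2 ?_
      filter_upwards [h1] with t'' h4
      rw [h4, h1.self_of_nhds]
    rw [mem_inf_principal]
    filter_upwards [h1] with t' h1 h2 using h1 h2
  filter_upwards [hcount.ae_notMem volume] with t ht htT
  by_contra h
  exact ht ⟨htT, h⟩

/-- On each cell the process is replaced by its value at the right end. These step processes are
jointly measurable and converge by right continuity, because the right end lies strictly beyond `t`.
-/
theorem aestronglyMeasurable_uncurry_of_right_continuous {Ω : Type*} {mΩ : MeasurableSpace Ω}
    {μ : Measure Ω} [SFinite μ] {T : ℝ} (hT : 0 < T) {f : ℝ → Ω → ℝ}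
    (hf : ∀ t ∈ Set.Icc 0 T, Measurable (f t))
    (hc : ∀ᵐ ω ∂μ, ∀ t ∈ Set.Ico 0 T, Tendsto (fun t' => f t' ω) (𝓝[>] t) (𝓝 (f t ω))) :
    AEStronglyMeasurable (fun p : ℝ × Ω => f p.1 p.2) ((volume.restrict (Set.Icc 0 T)).prod μ) := by
  set F : ℕ → ℝ × Ω → ℝ := fun N p => ∑ l ∈ Finset.range (N + 1),
    (Set.Ico (gridPoint T N l) (gridPoint T N (l + 1)) ×ˢ Set.univ).indicator
      (fun p : ℝ × Ω => f (gridPoint T N (l + 1)) p.2) p with hF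
  have hFm : ∀ N, Measurable (F N) := by
    intro N
    refine Finset.measurable_sum _ fun l hl => ?_
    refine Measurable.indicator ?_ (measurableSet_Ico.prod MeasurableSet.univ)
    exact (hf _ (gridPoint_mem hT.le (Finset.mem_range.1 hl))).comp measurable_snd
  have hFeq : ∀ N t ω, t ∈ Set.Ico 0 T → F N (t, ω) = f (gridPoint T N (gridIndex T N t + 1)) ω := by
    intro N t ω ht
    simp only [hF]
    rw [Finset.sum_eq_single_of_mem (gridIndex T N t)
      (Finset.mem_range.2 (gridIndex_lt hT N ht.1 ht.2))]
    · rw [Set.indicator_of_mem]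
      exact ⟨gridIndex_spec hT N ht.1, trivial⟩
    · intro l _ hl
      rw [Set.indicator_of_notMem]
      rintro ⟨⟨h1, h2⟩, -⟩
      exact hl (gridIndex_eq hT h1 h2).symm
  refine aestronglyMeasurable_of_tendsto_ae atTop (f := F)
    (fun N => (hFm N).aestronglyMeasurable) ?_
  have h1 : ∀ᵐ t ∂(volume.restrict (Set.Icc 0 T)), t ∈ Set.Ico 0 T := by
    rw [ae_restrict_iff' measurableSet_Icc]
    have : ∀ᵐ t : ℝ, t ≠ T := by simp [ae_iff, measure_singleton]
    filter_upwards [this] with t ht h using ⟨h.1, lt_of_le_of_ne h.2 ht⟩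
  filter_upwards [Measure.quasiMeasurePreserving_fst.ae h1,
    Measure.quasiMeasurePreserving_snd.ae hc] with p hp1 hp2
  have : (fun N => F N p) = fun N => f (gridPoint T N (gridIndex T N p.1 + 1)) p.2 :=
    funext fun N => hFeq N p.1 p.2 hp1
  rw [this]
  exact (hp2 p.1 hp1).comp (tendsto_gridPoint_gridIndex hT hp1.1).2

/-! ### Calculus of bounded measurable coefficients. -/

namespace BddMeasurableOn

variable {T : ℝ} {f g : ℝ → ℝ}

theorem const (T c : ℝ) : BddMeasurableOn T fun _ => c :=
  ⟨measurable_const, |c|, fun _ _ => le_rfl⟩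

theorem neg (hf : BddMeasurableOn T f) : BddMeasurableOn T fun t => -f t := by
  obtain ⟨hm, C, hC⟩ := hf
  exact ⟨hm.neg, C, fun t ht => by rw [abs_neg]; exact hC t ht⟩

theorem add (hf : BddMeasurableOn T f) (hg : BddMeasurableOn T g) :
    BddMeasurableOn T fun t => f t + g t := by
  obtain ⟨hm, C, hC⟩ := hf
  obtain ⟨hm', C', hC'⟩ := hg
  exact ⟨hm.add hm', C + C', fun t ht => (abs_add_le _ _).trans (add_le_add (hC t ht) (hC' t ht))⟩

theorem sub (hf : BddMeasurableOn T f) (hg : BddMeasurableOn T g) :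
    BddMeasurableOn T fun t => f t - g t := by
  simpa only [sub_eq_add_neg] using hf.add hg.neg

theorem mul (hf : BddMeasurableOn T f) (hg : BddMeasurableOn T g) :
    BddMeasurableOn T fun t => f t * g t := by
  obtain ⟨hm, C, hC⟩ := hf
  obtain ⟨hm', C', hC'⟩ := hg
  refine ⟨hm.mul hm', C * C', fun t ht => ?_⟩
  rw [abs_mul]
  exact mul_le_mul (hC t ht) (hC' t ht) (abs_nonneg _) ((abs_nonneg _).trans (hC t ht))

theorem pow_two (hf : BddMeasurableOn T f) : BddMeasurableOn T fun t => f t ^ 2 := by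
  simpa only [sq] using hf.mul hf

theorem div (hf : BddMeasurableOn T f) (hg : BddMeasurableOn T g) {δ : ℝ} (hδ : 0 < δ)
    (hgδ : ∀ t ∈ Set.Icc 0 T, δ < g t) : BddMeasurableOn T fun t => f t / g t := by
  obtain ⟨hm, C, hC⟩ := hf
  refine ⟨hm.div hg.1, C / δ, fun t ht => ?_⟩
  have h := hgδ t ht
  rw [abs_div, abs_of_pos (hδ.trans h)]
  exact div_le_div₀ ((abs_nonneg _).trans (hC t ht)) (hC t ht) hδ h.le

theorem finset_sum {ι : Type*} (S : Finset ι) {f : ι → ℝ → ℝ}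
    (hf : ∀ i ∈ S, BddMeasurableOn T (f i)) : BddMeasurableOn T fun t => ∑ i ∈ S, f i t := by
  classical
  induction S using Finset.induction_on with
  | empty => simpa using const T 0
  | insert a S ha ih =>
    simp only [Finset.sum_insert ha]
    exact (hf a (Finset.mem_insert_self _ _)).add
      (ih fun i hi => hf i (Finset.mem_insert_of_mem hi))

theorem of_continuousOn (hf : ContinuousOn f (Set.Icc 0 T)) : BddMeasurableOn T f :=
  ⟨(continuousOn_iff_continuous_domRestrict.1 hf).measurable,
    isCompact_Icc.exists_bound_of_continuousOn hf⟩

theorem aestronglyMeasurable (hf : BddMeasurableOn T f) :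
    AEStronglyMeasurable f (volume.restrict (Set.Icc 0 T)) :=
  (aemeasurable_restrict_of_measurable_subtype measurableSet_Icc hf.1).aestronglyMeasurable

theorem intervalIntegrable (hf : BddMeasurableOn T f) {a b : ℝ} (ha : a ∈ Set.Icc 0 T)
    (hb : b ∈ Set.Icc 0 T) : IntervalIntegrable f volume a b := by
  obtain ⟨C, hC⟩ := hf.2
  have h : IntegrableOn f (Set.Icc 0 T) := by
    refine Integrable.mono' (g := fun _ => C) (integrable_const C) hf.aestronglyMeasurable ?_
    rw [ae_restrict_iff' measurableSet_Icc]
    exact Eventually.of_forall hC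
  exact (h.mono_set (Set.uIcc_subset_Icc ha hb)).intervalIntegrable

end BddMeasurableOn

theorem exists_uniform_bound {ι α : Type*} [Fintype ι] {S : Set α} {f : ι → α → ℝ}
    (hf : ∀ i, ∃ C : ℝ, ∀ t ∈ S, |f i t| ≤ C) : ∃ C : ℝ, 0 ≤ C ∧ ∀ i, ∀ t ∈ S, |f i t| ≤ C := by
  choose C hC using hf
  refine ⟨∑ i, |C i|, Finset.sum_nonneg fun i _ => abs_nonneg _, fun i t ht => ?_⟩
  exact (hC i t ht).trans ((le_abs_self _).trans
    (Finset.single_le_sum (f := fun i => |C i|) (fun i _ => abs_nonneg _) (Finset.mem_univ i)))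

/-! ### Integrals along the regime process and its transition law. -/

namespace IsRegimeSwitching

variable {Ω : Type*} {mΩ : MeasurableSpace Ω} {m : ℕ} {μ : Measure Ω} {ℱ : Filtration ℝ mΩ}
  {T : ℝ} {rate : ℝ → Fin m → Fin m → ℝ} {s : ℝ → Ω → Fin m}

theorem tendsto_sum_integral (hs : IsRegimeSwitching μ ℱ T rate s) {h : ℝ → Fin m → ℝ}
    (hh : ∀ k, BddMeasurableOn T fun t => h t k) (ω : Ω) {t : ℝ} (ht0 : 0 < t) (htT : t ≤ T) :
    IntervalIntegrable (fun τ => h τ (s τ ω)) volume 0 t ∧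
    Tendsto (fun N : ℕ => ∑ l ∈ Finset.range (N + 1),
      ∫ τ in gridPoint t N l..gridPoint t N (l + 1), h τ (s (gridPoint t N l) ω))
      atTop (𝓝 (∫ τ in (0 : ℝ)..t, h τ (s τ ω))) := by
  obtain ⟨C, -, hC⟩ := exists_uniform_bound fun k => (hh k).2
  refine tendsto_sum_integral_gridPoint (H := fun a _ τ => h τ (s a ω)) (bound := fun _ => C) ht0
    intervalIntegrable_const (fun a _ b _ => ?_) (fun a b τ h0 h1 h2 h3 => ?_) ?_
  · exact (hh _).intervalIntegrable ⟨le_rfl, ht0.le.trans htT⟩ ⟨ht0.le, htT⟩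
  · exact hC _ τ ⟨h0.trans h1, h2.trans (h3.trans htT)⟩
  · filter_upwards [ae_eventually_eq_of_left_limit (hs.left_limit ω)] with τ hτ hτt
    refine tendsto_const_nhds.congr' ?_
    filter_upwards [tendsto_fst.eventually (hτ ⟨hτt.1, hτt.2.trans_le htT⟩)] with p hp
    rw [hp]

theorem intervalIntegrable (hs : IsRegimeSwitching μ ℱ T rate s) (hT : 0 < T) {h : ℝ → Fin m → ℝ}
    (hh : ∀ k, BddMeasurableOn T fun t => h t k) (ω : Ω) :
    IntervalIntegrable (fun t => h t (s t ω)) volume 0 T :=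
  (hs.tendsto_sum_integral hh ω hT le_rfl).1

/-- The grid partitions `[0,t]`, so each approximating sum involves only regimes up to time `t`.
Adaptedness of `s` thus suffices. -/
theorem measurable_integral (hs : IsRegimeSwitching μ ℱ T rate s) {h : ℝ → Fin m → ℝ}
    (hh : ∀ k, BddMeasurableOn T fun t => h t k) {t : ℝ} (ht : t ∈ Set.Icc 0 T) :
    Measurable[ℱ t] fun ω => ∫ τ in (0 : ℝ)..t, h τ (s τ ω) := by
  rcases ht.1.eq_or_lt with rfl | ht0
  · simp
  refine @measurable_of_tendsto_metrizable _ _ (ℱ t) _ _ _ _ (fun (N : ℕ) (ω : Ω) =>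
    ∑ l ∈ Finset.range (N + 1),
      ∫ τ in gridPoint t N l..gridPoint t N (l + 1), h τ (s (gridPoint t N l) ω)) _ (fun N => ?_)
    (tendsto_pi_nhds.2 fun ω => (hs.tendsto_sum_integral hh ω ht0 ht.2).2)
  refine Finset.measurable_fun_sum _ fun l hl => ?_
  have hl' := gridPoint_mem ht0.le (Finset.mem_range.1 hl).le
  have h1 : Measurable[ℱ t] (s (gridPoint t N l)) :=
    (hs.adapted _ ⟨hl'.1, hl'.2.trans ht.2⟩).mono (ℱ.mono hl'.2) le_rfl
  exact (Measurable.of_discrete (f := fun k =>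
    ∫ τ in gridPoint t N l..gridPoint t N (l + 1), h τ k)).comp h1

theorem aestronglyMeasurable (hs : IsRegimeSwitching μ ℱ T rate s) [SFinite μ] (hT : 0 < T)
    {h : ℝ → Fin m → ℝ} (hh : ∀ k, BddMeasurableOn T fun t => h t k) :
    AEStronglyMeasurable (fun p : ℝ × Ω => h p.1 (s p.1 p.2))
      ((volume.restrict (Set.Icc 0 T)).prod μ) := by
  have h1 : (fun p : ℝ × Ω => h p.1 (s p.1 p.2)) =
      -- Splitting by regime separates the coefficient, merely measurable in time, from the
      -- right-continuous indicator.
      fun p => ∑ k, h p.1 k * (if s p.1 p.2 = k then 1 else 0) := by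
    funext p; simp
  rw [h1]
  refine Finset.aestronglyMeasurable_fun_sum _ fun k _ => ?_
  refine AEStronglyMeasurable.mul (hh k).aestronglyMeasurable.comp_fst ?_
  refine aestronglyMeasurable_uncurry_of_right_continuous (f := fun t ω =>
    if s t ω = k then (1 : ℝ) else 0) hT (fun t ht => ?_) (Eventually.of_forall fun ω t ht => ?_)
  · exact (Measurable.of_discrete (f := fun j : Fin m => if j = k then (1 : ℝ) else 0)).comp
      ((hs.adapted t ht).mono (ℱ.le t) le_rfl)
  · refine tendsto_const_nhds.congr' ?_
    filter_upwards [hs.right_continuous ω t ht] with t' h'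
    rw [h']

/-- The transition law in weak form: `W` is `ℱ t`-measurable, so the indicator may be replaced by
its conditional expectation. The law says nothing where `s t = k`, which is why `W` must vanish
there. -/
theorem abs_integral_mul_sub_le (hs : IsRegimeSwitching μ ℱ T rate s) [IsProbabilityMeasure μ]
    {ρ : ℝ} {t ε : ℝ} (ht : 0 ≤ t)
    (hε : 0 < ε) (htε : t + ε ≤ T) (k : Fin m)
    (hρ : ∀ᵐ ω ∂μ, s t ω ≠ k →
      |(μ[Set.indicator {ω' | s (t + ε) ω' = k} (fun _ => (1 : ℝ)) | ℱ t]) ω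
        - ∫ t' in t..(t + ε), rate t' (s t ω) k| ≤ ρ)
    {W : Ω → ℝ} (hWm : Measurable[ℱ t] W) (hWi : Integrable W μ)
    (hW0 : ∀ ω, s t ω = k → W ω = 0) :
    Integrable (fun ω => W ω * ((if s (t + ε) ω = k then 1 else 0)
        - ∫ t' in t..(t + ε), rate t' (s t ω) k)) μ ∧
    |∫ ω, W ω * ((if s (t + ε) ω = k then 1 else 0)
        - ∫ t' in t..(t + ε), rate t' (s t ω) k) ∂μ| ≤ ρ * ∫ ω, |W ω| ∂μ := by
  have htT : t ∈ Set.Icc 0 T := ⟨ht, by linarith⟩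
  have htεT : t + ε ∈ Set.Icc 0 T := ⟨by linarith, htε⟩
  set f : Ω → ℝ := Set.indicator {ω' | s (t + ε) ω' = k} (fun _ => (1 : ℝ)) with hf
  have hset : MeasurableSet {ω' | s (t + ε) ω' = k} :=
    ((hs.adapted _ htεT).mono (ℱ.le _) le_rfl) (measurableSet_singleton k)
  have hfi : Integrable f μ := (integrable_const (1 : ℝ)).indicator hset
  have hfif : ∀ ω, f ω = if s (t + ε) ω = k then 1 else 0 := fun ω => by
    simp only [hf, Set.indicator_apply, Set.mem_ofPred_eq]
  have hf1 : ∀ ω, ‖f ω‖ ≤ 1 := fun ω => by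
    rw [hfif]; split_ifs <;> simp
  set J : Ω → ℝ := fun ω => ∫ t' in t..(t + ε), rate t' (s t ω) k with hJ
  obtain ⟨CJ, hCJ⟩ : ∃ C, ∀ ω, ‖J ω‖ ≤ C := by
    refine ⟨∑ j, |∫ t' in t..(t + ε), rate t' j k|, fun ω => ?_⟩
    exact Finset.single_le_sum (f := fun j => |∫ t' in t..(t + ε), rate t' j k|)
      (fun i _ => abs_nonneg _) (Finset.mem_univ (s t ω))
  have hJm : Measurable J := (Measurable.of_discrete (f := fun j =>
    ∫ t' in t..(t + ε), rate t' j k)).comp ((hs.adapted _ htT).mono (ℱ.le _) le_rfl)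
  have hWJ : Integrable (fun ω => W ω * J ω) μ :=
    hWi.mul_bdd hJm.aestronglyMeasurable (Eventually.of_forall hCJ)
  have hWf : Integrable (fun ω => W ω * f ω) μ :=
    hWi.mul_bdd hfi.aestronglyMeasurable (Eventually.of_forall hf1)
  have hpull : μ[fun ω => W ω * f ω | ℱ t] =ᵐ[μ] fun ω => W ω * (μ[f | ℱ t]) ω :=
    condExp_mul_of_stronglyMeasurable_left hWm.stronglyMeasurable hWf hfi
  have hWc : Integrable (fun ω => W ω * (μ[f | ℱ t]) ω) μ :=
    integrable_condExp.congr hpull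
  have hint : ∫ ω, W ω * f ω ∂μ = ∫ ω, W ω * (μ[f | ℱ t]) ω ∂μ := by
    rw [← integral_congr_ae hpull, integral_condExp]
  have hsub : ∀ ω, W ω * ((if s (t + ε) ω = k then 1 else 0)
      - ∫ t' in t..(t + ε), rate t' (s t ω) k) = W ω * f ω - W ω * J ω := fun ω => by rw [hfif]; simp only [hJ]; ring
  simp_rw [hsub]
  refine ⟨hWf.sub hWJ, ?_⟩
  rw [integral_sub hWf hWJ, hint, ← integral_sub hWc hWJ, ← integral_const_mul,
    ← Real.norm_eq_abs]
  refine norm_integral_le_of_norm_le (hWi.abs.const_mul ρ) ?_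
  filter_upwards [hρ] with ω h
  rw [← mul_sub, norm_mul, mul_comm, Real.norm_eq_abs, Real.norm_eq_abs]
  by_cases hk : s t ω = k
  · simp [hW0 ω hk]
  · exact mul_le_mul_of_nonneg_right (h hk) (abs_nonneg _)

end IsRegimeSwitching

/-! ### Dynkin's formula. -/

theorem continuousOn_of_eq_add_integral {y h : ℝ → ℝ} {T : ℝ} (hT : 0 ≤ T)
    (hh : IntervalIntegrable h volume 0 T)
    (hy : ∀ t ∈ Set.Icc 0 T, y t = y 0 + ∫ τ in (0 : ℝ)..t, h τ) :
    ContinuousOn y (Set.Icc 0 T) := by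
  have h1 := intervalIntegral.continuousOn_primitive_interval (f := h) (μ := volume) (a := 0)
    (b := T) (by rwa [Set.uIcc_of_le hT, ← intervalIntegrable_iff_integrableOn_Icc_of_le hT])
  rw [Set.uIcc_of_le hT] at h1
  exact (continuousOn_const.add h1).congr hy

theorem sub_eq_integral_of_eq_add_integral {y h : ℝ → ℝ} {T a b : ℝ}
    (hh : IntervalIntegrable h volume 0 T)
    (hy : ∀ t ∈ Set.Icc 0 T, y t = y 0 + ∫ τ in (0 : ℝ)..t, h τ)
    (ha : a ∈ Set.Icc 0 T) (hb : b ∈ Set.Icc 0 T) : y b - y a = ∫ τ in a..b, h τ := by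
  have hT : 0 ≤ T := ha.1.trans ha.2
  have hsub : ∀ c ∈ Set.Icc 0 T, IntervalIntegrable h volume 0 c := fun c hc =>
    hh.mono_set (by
      rw [Set.uIcc_of_le hc.1, Set.uIcc_of_le hT]; exact Set.Icc_subset_Icc_right hc.2)
  rw [hy b hb, hy a ha, ← intervalIntegral.integral_interval_sub_left (hsub b hb) (hsub a ha)]
  ring

namespace IsRegimeSwitching

variable {Ω : Type*} {mΩ : MeasurableSpace Ω} {m : ℕ} {μ : Measure Ω} {ℱ : Filtration ℝ mΩ}
  {T : ℝ} {rate : ℝ → Fin m → Fin m → ℝ} {s : ℝ → Ω → Fin m}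

/-- The predictable increment, over the interval `[a,b]`, of the product of a function of time and
regime and of a process. -/
noncomputable def compensator (rate : ℝ → Fin m → Fin m → ℝ) (s : ℝ → Ω → Fin m) (g : ℝ → Fin m → ℝ)
    (Z : ℝ → Ω → ℝ) (a b : ℝ) (ω : Ω) : ℝ :=
  Z a ω * (g b (s a ω) - g a (s a ω))
    + ∑ k, Z a ω * (g b k - g b (s a ω)) * (∫ t in a..b, rate t (s a ω) k)
    + g b (s b ω) * (Z b ω - Z a ω)

theorem measurable_comp (hs : IsRegimeSwitching μ ℱ T rate s) {t : ℝ} (ht : t ∈ Set.Icc 0 T)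
    (f : Fin m → ℝ) : Measurable[ℱ t] fun ω => f (s t ω) :=
  (Measurable.of_discrete (f := f)).comp (hs.adapted t ht)

theorem measurable_compensator (hs : IsRegimeSwitching μ ℱ T rate s) {g : ℝ → Fin m → ℝ}
    {Z : ℝ → Ω → ℝ} (hZm : ∀ t ∈ Set.Icc 0 T, Measurable[ℱ t] (Z t)) {a b : ℝ}
    (ha : a ∈ Set.Icc 0 T) (hb : b ∈ Set.Icc 0 T) :
    Measurable (compensator rate s g Z a b) := by
  have hZ : ∀ t ∈ Set.Icc 0 T, Measurable (Z t) := fun t ht => (hZm t ht).mono (ℱ.le t) le_rfl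
  have hf : ∀ t ∈ Set.Icc 0 T, ∀ f : Fin m → ℝ, Measurable fun ω => f (s t ω) := fun t ht f =>
    (hs.measurable_comp ht f).mono (ℱ.le t) le_rfl
  unfold compensator
  refine Measurable.add (Measurable.add ((hZ a ha).mul (hf a ha fun k => g b k - g a k)) ?_)
    ((hf b hb (g b)).mul ((hZ b hb).sub (hZ a ha)))
  refine Finset.measurable_sum _ fun k _ => ?_
  exact ((hZ a ha).mul (hf a ha fun j => g b k - g b j)).mul
    (hf a ha fun j => ∫ t in a..b, rate t j k)

/-- The increment of `g Z` splits into a time change of `g` with the regime frozen, a regime change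
with `Z` frozen, and a change of `Z`. The compensator alters only the regime change, replacing jump
indicators by integrated rates. The weight of a jump to `k` contains `g b k - g b (s a)`, which
vanishes when `s a = k`, so diagonal rates play no role. -/
theorem integral_increment_sub_compensator_le (hs : IsRegimeSwitching μ ℱ T rate s)
    [IsProbabilityMeasure μ] {g : ℝ → Fin m → ℝ} {C₀ : ℝ} (hC₀ : 0 ≤ C₀)
    (hg : ∀ k, ∀ t ∈ Set.Icc 0 T, |g t k| ≤ C₀) {Z : ℝ → Ω → ℝ}
    (hZm : ∀ t ∈ Set.Icc 0 T, Measurable[ℱ t] (Z t)) {D : Ω → ℝ} (hD : Integrable D μ)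
    (hZD : ∀ᵐ ω ∂μ, ∀ t ∈ Set.Icc 0 T, |Z t ω| ≤ D ω) {ρ : ℝ → ℝ}
    (hρ : ∀ t ε : ℝ, 0 ≤ t → 0 < ε → t + ε ≤ T → ∀ s' : Fin m, ∀ᵐ ω ∂μ, s t ω ≠ s' →
      |(μ[Set.indicator {ω' | s (t + ε) ω' = s'} (fun _ => (1 : ℝ)) | ℱ t]) ω
        - ∫ t' in t..(t + ε), rate t' (s t ω) s'| ≤ ρ ε)
    {a ε : ℝ} (ha : 0 ≤ a) (hε : 0 < ε) (haε : a + ε ≤ T) :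
    Integrable (fun ω => g (a + ε) (s (a + ε) ω) * Z (a + ε) ω - g a (s a ω) * Z a ω
        - compensator rate s g Z a (a + ε) ω) μ ∧
    |∫ ω, (g (a + ε) (s (a + ε) ω) * Z (a + ε) ω - g a (s a ω) * Z a ω
        - compensator rate s g Z a (a + ε) ω) ∂μ| ≤ m * (|ρ ε| * (2 * C₀ * ∫ ω, D ω ∂μ)) := by
  have haT : a ∈ Set.Icc 0 T := ⟨ha, by linarith⟩
  have hbT : a + ε ∈ Set.Icc 0 T := ⟨by linarith, haε⟩
  set b := a + ε with hb
  have hW : ∀ k : Fin m, Integrable (fun ω => Z a ω * (g b k - g b (s a ω))) μ ∧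
      ∫ ω, |Z a ω * (g b k - g b (s a ω))| ∂μ ≤ 2 * C₀ * ∫ ω, D ω ∂μ := by
    intro k
    have hm : Measurable (fun ω => Z a ω * (g b k - g b (s a ω))) :=
      ((hZm a haT).mul (hs.measurable_comp haT fun j => g b k - g b j)).mono (ℱ.le a) le_rfl
    have hle : ∀ᵐ ω ∂μ, |Z a ω * (g b k - g b (s a ω))| ≤ 2 * C₀ * D ω := by
      filter_upwards [hZD] with ω h
      rw [abs_mul, mul_comm]
      have h1 : |g b k - g b (s a ω)| ≤ 2 * C₀ :=
        (abs_sub _ _).trans (by linarith [hg k b hbT, hg (s a ω) b hbT])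
      exact mul_le_mul h1 (h a haT) (abs_nonneg _) (by positivity)
    have hi : Integrable (fun ω => Z a ω * (g b k - g b (s a ω))) μ :=
      (hD.const_mul (2 * C₀)).mono' hm.aestronglyMeasurable hle
    refine ⟨hi, ?_⟩
    rw [← integral_const_mul]
    exact integral_mono_ae hi.abs (hD.const_mul _) hle
  have hstep := fun k => hs.abs_integral_mul_sub_le ha hε haε k (hρ a ε ha hε haε k)
    (W := fun ω => Z a ω * (g b k - g b (s a ω)))
    ((hZm a haT).mul (hs.measurable_comp haT fun j => g b k - g b j)) (hW k).1
    (fun ω hω => by rw [hω]; ring)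
  have heq : ∀ ω, g b (s b ω) * Z b ω - g a (s a ω) * Z a ω - compensator rate s g Z a b ω
      = ∑ k, (Z a ω * (g b k - g b (s a ω))) * ((if s b ω = k then 1 else 0)
        - ∫ t' in a..b, rate t' (s a ω) k) := by
    intro ω
    simp only [mul_sub, Finset.sum_sub_distrib, compensator, mul_ite, mul_one, mul_zero,
      Finset.sum_ite_eq, Finset.mem_univ, if_true]
    ring
  simp_rw [heq]
  refine ⟨integrable_finsetSum _ fun k _ => (hstep k).1, ?_⟩
  rw [integral_finsetSum _ fun k _ => (hstep k).1]
  refine (Finset.abs_sum_le_sum_abs _ _).trans ?_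
  calc _ ≤ ∑ _k : Fin m, |ρ ε| * (2 * C₀ * ∫ ω, D ω ∂μ) := by
        refine Finset.sum_le_sum fun k _ => (hstep k).2.trans ?_
        refine mul_le_mul (le_abs_self _) (hW k).2 (integral_nonneg fun _ => abs_nonneg _)
          (abs_nonneg _)
    _ = _ := by simp

/-- The sum of compensators over the grid has two limits: pathwise, and then in expectation by
domination, it tends to the integral of the generator; in expectation it also tends to the total
increment, which telescopes. -/
theorem integral_dynkin (hs : IsRegimeSwitching μ ℱ T rate s) [IsProbabilityMeasure μ]
    (hT : 0 < T) (hrate : ∀ k k', BddMeasurableOn T fun t => rate t k k')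
    {g g' : ℝ → Fin m → ℝ} (hg' : ∀ k, BddMeasurableOn T fun t => g' t k)
    (hgc : ∀ k, ContinuousOn (fun t => g t k) (Set.Icc 0 T))
    (hg : ∀ k, ∀ a ∈ Set.Icc 0 T, ∀ b ∈ Set.Icc 0 T, g b k - g a k = ∫ t in a..b, g' t k)
    {Z ζ : ℝ → Ω → ℝ} (hZm : ∀ t ∈ Set.Icc 0 T, Measurable[ℱ t] (Z t))
    (hζ : ∀ᵐ ω ∂μ, IntervalIntegrable (fun t => ζ t ω) volume 0 T)
    (hZ : ∀ᵐ ω ∂μ, ∀ t ∈ Set.Icc 0 T, Z t ω = Z 0 ω + ∫ τ in (0 : ℝ)..t, ζ τ ω)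
    {D D' : Ω → ℝ} (hD : Integrable D μ) (hZD : ∀ᵐ ω ∂μ, ∀ t ∈ Set.Icc 0 T, |Z t ω| ≤ D ω)
    (hD' : Integrable D' μ) (hζD' : ∀ᵐ ω ∂μ, ∫ t in (0 : ℝ)..T, |ζ t ω| ≤ D' ω) :
    (∀ᵐ ω ∂μ, IntervalIntegrable (fun t => g' t (s t ω) * Z t ω
      + (∑ k, (g t k - g t (s t ω)) * rate t (s t ω) k) * Z t ω + g t (s t ω) * ζ t ω) volume 0 T) ∧
    Integrable (fun ω => ∫ t in (0 : ℝ)..T, (g' t (s t ω) * Z t ω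
      + (∑ k, (g t k - g t (s t ω)) * rate t (s t ω) k) * Z t ω + g t (s t ω) * ζ t ω)) μ ∧
    ∫ ω, (∫ t in (0 : ℝ)..T, (g' t (s t ω) * Z t ω
      + (∑ k, (g t k - g t (s t ω)) * rate t (s t ω) k) * Z t ω + g t (s t ω) * ζ t ω)) ∂μ
      = ∫ ω, (g T (s T ω) * Z T ω - g 0 (s 0 ω) * Z 0 ω) ∂μ := by
  obtain ⟨C₀, hC₀, hgC⟩ := exists_uniform_bound (S := Set.Icc 0 T) (f := fun k t => g t k)
    fun k => (BddMeasurableOn.of_continuousOn (hgc k)).2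
  obtain ⟨C₁, hC₁, hg'C⟩ := exists_uniform_bound fun k => (hg' k).2
  obtain ⟨R, hR, hrateR⟩ := exists_uniform_bound (S := Set.Icc 0 T)
    (f := fun (p : Fin m × Fin m) t => rate t p.1 p.2) fun p => (hrate p.1 p.2).2
  set L : Ω → ℝ → ℝ := fun ω t => g' t (s t ω) * Z t ω
    + (∑ k, (g t k - g t (s t ω)) * rate t (s t ω) k) * Z t ω + g t (s t ω) * ζ t ω with hL
  -- `H ω a b` integrates over `[a,b]` to the compensator and reduces to the generator `L ω t` when
  -- `a = b = t`.
  set H : Ω → ℝ → ℝ → ℝ → ℝ := fun ω a b t => g' t (s a ω) * Z a ω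
    + (∑ k, (g b k - g b (s a ω)) * rate t (s a ω) k) * Z a ω + g b (s b ω) * ζ t ω with hH
  -- Bounds the factor of `Z` in `H`: `C₁` for `g'`, and `2 C₀ R` for each possible target regime.
  set K : ℝ := C₁ + m * (2 * C₀ * R) with hK
  have hK0 : 0 ≤ K := by positivity
  have h0T : (0 : ℝ) ∈ Set.Icc 0 T := ⟨le_rfl, hT.le⟩
  have hTT : T ∈ Set.Icc 0 T := ⟨hT.le, le_rfl⟩
  have hsub : ∀ {a b}, a ∈ Set.Icc 0 T → b ∈ Set.Icc 0 T → ∀ {f : ℝ → ℝ},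
      IntervalIntegrable f volume 0 T → IntervalIntegrable f volume a b := fun ha hb f hf =>
    hf.mono_set ((Set.uIcc_subset_Icc ha hb).trans (Set.uIcc_of_le hT.le).ge)
  have hHle : ∀ᵐ ω ∂μ, ∀ a b t, 0 ≤ a → a ≤ t → t ≤ b → b ≤ T →
      |H ω a b t| ≤ K * D ω + C₀ * |ζ t ω| := by
    filter_upwards [hZD] with ω hω a b t ha hat htb hbT
    have haT : a ∈ Set.Icc 0 T := ⟨ha, hat.trans (htb.trans hbT)⟩
    have htT : t ∈ Set.Icc 0 T := ⟨ha.trans hat, htb.trans hbT⟩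
    have hbT' : b ∈ Set.Icc 0 T := ⟨htT.1.trans htb, hbT⟩
    have h1 : |g' t (s a ω) + ∑ k, (g b k - g b (s a ω)) * rate t (s a ω) k| ≤ K := by
      refine (abs_add_le _ _).trans (add_le_add (hg'C _ t htT) ?_)
      refine (Finset.abs_sum_le_sum_abs _ _).trans ?_
      calc _ ≤ ∑ _k : Fin m, 2 * C₀ * R := by
            refine Finset.sum_le_sum fun k _ => ?_
            rw [abs_mul]
            refine mul_le_mul ((abs_sub _ _).trans ?_) (hrateR (s a ω, k) t htT)
              (abs_nonneg _) (by positivity)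
            linarith [hgC k b hbT', hgC (s a ω) b hbT']
        _ = _ := by simp
    simp only [hH]
    rw [← add_mul]
    refine (abs_add_le _ _).trans (add_le_add ?_ ?_)
    · rw [abs_mul]
      exact mul_le_mul h1 (hω a haT) (abs_nonneg _) hK0
    · rw [abs_mul]
      exact mul_le_mul_of_nonneg_right (hgC _ b hbT') (abs_nonneg _)
  have hHint : ∀ᵐ ω ∂μ, ∀ a b, IntervalIntegrable (H ω a b) volume 0 T := by
    filter_upwards [hζ] with ω hω a b
    refine IntervalIntegrable.add (IntervalIntegrable.add
      (((hg' _).intervalIntegrable h0T hTT).mul_const _) ?_) (hω.const_mul _)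
    exact ((BddMeasurableOn.finset_sum _ fun k _ =>
      (BddMeasurableOn.const T _).mul (hrate _ k)).intervalIntegrable h0T hTT).mul_const _
  have hHcomp : ∀ᵐ ω ∂μ, ∀ a ∈ Set.Icc 0 T, ∀ b ∈ Set.Icc 0 T,
      ∫ t in a..b, H ω a b t = compensator rate s g Z a b ω := by
    filter_upwards [hζ, hZ] with ω hω hω' a ha b hb
    have i1 : IntervalIntegrable (fun t => g' t (s a ω) * Z a ω) volume a b :=
      ((hg' _).intervalIntegrable ha hb).mul_const _
    have i2 : ∀ k, IntervalIntegrable (fun t => (g b k - g b (s a ω)) * rate t (s a ω) k)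
        volume a b := fun k => ((hrate _ k).intervalIntegrable ha hb).const_mul _
    have i2' : IntervalIntegrable (fun t => (∑ k, (g b k - g b (s a ω)) * rate t (s a ω) k) * Z a ω)
        volume a b := by
      have := IntervalIntegrable.sum (Finset.univ) fun k _ => i2 k
      simp only [Finset.sum_fn] at this
      exact this.mul_const _
    have i3 : IntervalIntegrable (fun t => g b (s b ω) * ζ t ω) volume a b :=
      (hsub ha hb hω).const_mul _
    simp only [hH, compensator]
    rw [intervalIntegral.integral_add (i1.add i2') i3, intervalIntegral.integral_add i1 i2',
      intervalIntegral.integral_mul_const, intervalIntegral.integral_mul_const,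
      intervalIntegral.integral_const_mul, ← hg _ a ha b hb,
      ← sub_eq_integral_of_eq_add_integral hω hω' ha hb,
      intervalIntegral.integral_finsetSum fun k _ => i2 k, Finset.sum_mul]
    simp only [intervalIntegral.integral_const_mul]
    congr 2
    · ring
    · exact Finset.sum_congr rfl fun k _ => by ring
  set X : ℕ → Ω → ℝ := fun N ω => ∑ l ∈ Finset.range (N + 1),
    compensator rate s g Z (gridPoint T N l) (gridPoint T N (l + 1)) ω with hX
  have hmem : ∀ {N l}, l ∈ Finset.range (N + 1) → gridPoint T N l ∈ Set.Icc 0 T ∧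
      gridPoint T N (l + 1) ∈ Set.Icc 0 T := fun h =>
    ⟨gridPoint_mem hT.le (Finset.mem_range.1 h).le, gridPoint_mem hT.le (Finset.mem_range.1 h)⟩
  have hXm : ∀ N, AEStronglyMeasurable (X N) μ := fun N =>
    (Finset.measurable_fun_sum _ fun l hl =>
      hs.measurable_compensator hZm (hmem hl).1 (hmem hl).2).aestronglyMeasurable
  have hXle : ∀ N, ∀ᵐ ω ∂μ, ‖X N ω‖ ≤ K * T * D ω + C₀ * D' ω := by
    intro N
    filter_upwards [hHcomp, hHle, hHint, hζ, hζD'] with ω h1 h2 h3 h4 h5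
    have hbnd : IntervalIntegrable (fun t => K * D ω + C₀ * |ζ t ω|) volume 0 T :=
      intervalIntegrable_const.add (h4.abs.const_mul _)
    calc ‖X N ω‖ ≤ ∑ l ∈ Finset.range (N + 1),
          ∫ t in gridPoint T N l..gridPoint T N (l + 1), (K * D ω + C₀ * |ζ t ω|) := by
          refine (norm_sum_le _ _).trans (Finset.sum_le_sum fun l hl => ?_)
          obtain ⟨ha, hb⟩ := hmem hl
          have hab := gridPoint_mono hT.le N l.le_succ
          rw [← h1 _ ha _ hb]
          exact intervalIntegral.norm_integral_le_of_norm_le hab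
            (Eventually.of_forall fun t ht => h2 _ _ t ha.1 ht.1.le ht.2 hb.2)
            (hsub ha hb hbnd)
      _ = ∫ t in (0 : ℝ)..T, (K * D ω + C₀ * |ζ t ω|) := by
          have := intervalIntegral.sum_integral_adjacent_intervals (a := gridPoint T N)
            (n := N + 1) (f := fun t => K * D ω + C₀ * |ζ t ω|) (μ := volume) fun l hl =>
            hsub (hmem (Finset.mem_range.2 hl)).1 (hmem (Finset.mem_range.2 hl)).2 hbnd
          rwa [gridPoint_zero, gridPoint_last] at this
      _ = K * T * D ω + C₀ * ∫ t in (0 : ℝ)..T, |ζ t ω| := by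
          rw [intervalIntegral.integral_add intervalIntegrable_const (h4.abs.const_mul _),
            intervalIntegral.integral_const_mul]
          simp; ring
      _ ≤ _ := by gcongr
  have hXlim : ∀ᵐ ω ∂μ, IntervalIntegrable (L ω) volume 0 T ∧
      Tendsto (fun N => X N ω) atTop (𝓝 (∫ t in (0 : ℝ)..T, L ω t)) := by
    filter_upwards [hHcomp, hHle, hHint, hζ, hZ] with ω h1 h2 h3 h4 h5
    have hbnd : IntervalIntegrable (fun t => K * D ω + C₀ * |ζ t ω|) volume 0 T :=
      intervalIntegrable_const.add (h4.abs.const_mul _)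
    have hlim := tendsto_sum_integral_gridPoint hT (H := H ω) (L := L ω) hbnd
      (fun a _ b _ => h3 a b) h2 ?_
    · refine ⟨hlim.1, hlim.2.congr fun N => Finset.sum_congr rfl fun l hl => ?_⟩
      exact h1 _ (hmem hl).1 _ (hmem hl).2
    · filter_upwards [ae_eventually_eq_of_left_limit (hs.left_limit ω)] with t ht htT
      have hZc : Tendsto (fun p : ℝ × ℝ => Z p.1 ω) (𝓝 t ×ˢ 𝓝 t) (𝓝 (Z t ω)) :=
        (((continuousOn_of_eq_add_integral hT.le h4 h5).continuousAt
          (Icc_mem_nhds htT.1 htT.2)).tendsto).comp tendsto_fst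
      have hgt : ∀ k, Tendsto (fun p : ℝ × ℝ => g p.2 k) (𝓝 t ×ˢ 𝓝 t) (𝓝 (g t k)) := fun k =>
        (((hgc k).continuousAt (Icc_mem_nhds htT.1 htT.2)).tendsto).comp tendsto_snd
      have hlim : Tendsto (fun p : ℝ × ℝ => g' t (s t ω) * Z p.1 ω
          + (∑ k, (g p.2 k - g p.2 (s t ω)) * rate t (s t ω) k) * Z p.1 ω
          + g p.2 (s t ω) * ζ t ω) (𝓝 t ×ˢ 𝓝 t) (𝓝 (L ω t)) :=
        ((hZc.const_mul _).add ((tendsto_finsetSum _ fun k _ =>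
          ((hgt k).sub (hgt _)).mul_const _).mul hZc)).add ((hgt _).mul_const _)
      refine hlim.congr' ?_
      filter_upwards [tendsto_fst.eventually (ht htT), tendsto_snd.eventually (ht htT)] with p h h'
      simp only [hH]
      rw [h, h']
  have hbound : Integrable (fun ω => K * T * D ω + C₀ * D' ω) μ :=
    (hD.const_mul _).add (hD'.const_mul _)
  have hXi : ∀ N, Integrable (X N) μ := fun N => hbound.mono' (hXm N) (hXle N)
  have hmain : Tendsto (fun N => ∫ ω, X N ω ∂μ) atTop (𝓝 (∫ ω, (∫ t in (0 : ℝ)..T, L ω t) ∂μ)) :=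
    tendsto_integral_of_dominated_convergence _ hXm hbound hXle (hXlim.mono fun ω h => h.2)
  refine ⟨hXlim.mono fun ω h => h.1, ?_, ?_⟩
  -- `ζ` is not assumed jointly measurable; measurability of the integral in `ω` is inherited from
  -- the sums `X N`.
  · refine hbound.mono' (aestronglyMeasurable_of_tendsto_ae atTop hXm
      (hXlim.mono fun ω h => h.2)) ?_
    filter_upwards [hXlim, ae_all_iff.2 hXle] with ω h1 h2
    exact le_of_tendsto h1.2.norm (Eventually.of_forall h2)
  obtain ⟨ρ, hρo, hρ⟩ := hs.transition
  set V : ℝ → Ω → ℝ := fun t ω => g t (s t ω) * Z t ω with hV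
  have herr : ∀ N, |∫ ω, (V T ω - V 0 ω) ∂μ - ∫ ω, X N ω ∂μ|
      ≤ ((N : ℝ) + 1) * (m * (|ρ (T / (N + 1))| * (2 * C₀ * ∫ ω, D ω ∂μ))) := by
    intro N
    have hstep : ∀ l ∈ Finset.range (N + 1),
        Integrable (fun ω => V (gridPoint T N (l + 1)) ω - V (gridPoint T N l) ω
          - compensator rate s g Z (gridPoint T N l) (gridPoint T N (l + 1)) ω) μ ∧
        |∫ ω, (V (gridPoint T N (l + 1)) ω - V (gridPoint T N l) ω
          - compensator rate s g Z (gridPoint T N l) (gridPoint T N (l + 1)) ω) ∂μ|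
          ≤ m * (|ρ (T / (N + 1))| * (2 * C₀ * ∫ ω, D ω ∂μ)) := by
      intro l hl
      obtain ⟨ha, hb⟩ := hmem hl
      rw [gridPoint_succ] at hb ⊢
      exact hs.integral_increment_sub_compensator_le hC₀ hgC hZm hD hZD hρ ha.1 (by positivity) hb.2
    have htel : ∀ ω, ∑ l ∈ Finset.range (N + 1),
        (V (gridPoint T N (l + 1)) ω - V (gridPoint T N l) ω
          - compensator rate s g Z (gridPoint T N l) (gridPoint T N (l + 1)) ω)
        = V T ω - V 0 ω - X N ω := by
      intro ω
      rw [Finset.sum_sub_distrib, Finset.sum_range_sub fun l => V (gridPoint T N l) ω,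
        gridPoint_zero, gridPoint_last]
    have hi := integrable_finsetSum _ fun l hl => (hstep l hl).1
    simp_rw [htel] at hi
    have hi' : Integrable (fun ω => V T ω - V 0 ω) μ := by
      refine (hi.add (hXi N)).congr (Eventually.of_forall fun ω => ?_)
      simp
    rw [← integral_sub hi' (hXi N)]
    simp_rw [← htel]
    rw [integral_finsetSum _ fun l hl => (hstep l hl).1]
    refine (Finset.abs_sum_le_sum_abs _ _).trans
      ((Finset.sum_le_sum fun l hl => (hstep l hl).2).trans_eq ?_)
    simp
  have hstep0 : Tendsto (fun N : ℕ => T / ((N : ℝ) + 1)) atTop (𝓝[>] 0) :=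
    tendsto_nhdsWithin_iff.2 ⟨tendsto_const_nhds.div_atTop
      (tendsto_atTop_add_const_right _ _ tendsto_natCast_atTop_atTop),
      Eventually.of_forall fun N => show 0 < T / ((N : ℝ) + 1) by positivity⟩
  -- This is where uniformity of the `o(ε)` in time matters: `N + 1` cells share the same error `ρ
  -- (T/(N+1))`.
  have hρ0 : Tendsto (fun N : ℕ => ((N : ℝ) + 1) * |ρ (T / (N + 1))|) atTop (𝓝 0) := by
    have h1 := (hρo.tendsto_div_nhds_zero.comp hstep0).abs.const_mul T
    simp only [abs_zero, mul_zero] at h1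
    refine h1.congr fun N => ?_
    have hN : (0 : ℝ) < N + 1 := by positivity
    simp only [Function.comp]
    rw [abs_div, abs_of_pos (show 0 < T / ((N : ℝ) + 1) by positivity)]
    field_simp
  have herr0 : Tendsto (fun N : ℕ => ∫ ω, (V T ω - V 0 ω) ∂μ - ∫ ω, X N ω ∂μ) atTop (𝓝 0) := by
    refine squeeze_zero_norm herr ?_
    have := hρ0.mul_const (m * (2 * C₀ * ∫ ω, D ω ∂μ))
    rw [zero_mul] at this
    exact this.congr fun N => by ring
  have := tendsto_nhds_unique herr0 (tendsto_const_nhds.sub hmain)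
  linarith

end IsRegimeSwitching

/-! ### Backward integral equations: existence and comparison. -/

/-- In the norm weighted by `exp (-2K(T-t))` the Picard map contracts by `1/2` on all of `[0,T]`, so
one fixed point suffices and no local solutions need to be glued. -/
theorem exists_backward_integral_solution {E : Type*} [NormedAddCommGroup E] [NormedSpace ℝ E]
    [CompleteSpace E] {T K : ℝ} (hT : 0 ≤ T) (hK : 0 < K) {f : ℝ → E → E}
    (hf : ∀ u : ℝ → E, Continuous u → IntervalIntegrable (fun t => f t (u t)) volume 0 T)
    (hlip : ∀ t ∈ Set.Icc 0 T, ∀ u v, ‖f t u - f t v‖ ≤ K * ‖u - v‖) (x : E) :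
    ∃ u : ℝ → E, Continuous u ∧ ∀ t ∈ Set.Icc 0 T, u t = x + ∫ τ in t..T, f τ (u τ) := by
  -- The weight is carried by the unknown: `w` is the weighted solution with the plain sup norm, and
  -- `lift w` is the solution itself.
  set lift : C(Set.Icc 0 T, E) → ℝ → E := fun w τ =>
    Real.exp (2 * K * (T - τ)) • w (Set.projIcc 0 T hT τ) with hlift
  have hliftc : ∀ w, Continuous (lift w) := fun w =>
    Continuous.smul (by fun_prop) (w.continuous.comp continuous_projIcc)
  have hsub : ∀ {a b}, a ∈ Set.Icc 0 T → b ∈ Set.Icc 0 T → ∀ {f : ℝ → E},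
      IntervalIntegrable f volume 0 T → IntervalIntegrable f volume a b := fun ha hb f hf =>
    hf.mono_set ((Set.uIcc_subset_Icc ha hb).trans (Set.uIcc_of_le hT).ge)
  have hTT : T ∈ Set.Icc 0 T := ⟨hT, le_rfl⟩
  have h0T : (0 : ℝ) ∈ Set.Icc 0 T := ⟨le_rfl, hT⟩
  have hcont : ∀ w, ContinuousOn (fun t => ∫ τ in t..T, f τ (lift w τ)) (Set.Icc 0 T) := by
    intro w
    have h1 := intervalIntegral.continuousOn_primitive_interval_left
      (f := fun τ => f τ (lift w τ)) (μ := volume) (a := 0) (b := T) (by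
        rw [Set.uIcc_of_le hT, ← intervalIntegrable_iff_integrableOn_Icc_of_le hT]
        exact hf _ (hliftc w))
    rwa [Set.uIcc_of_le hT] at h1
  set Φ : C(Set.Icc 0 T, E) → C(Set.Icc 0 T, E) := fun w =>
    ⟨fun t => Real.exp (-(2 * K * (T - t))) • (x + ∫ τ in (t : ℝ)..T, f τ (lift w τ)),
      Continuous.smul (by fun_prop)
        (continuous_const.add (continuousOn_iff_continuous_domRestrict.1 (hcont w)))⟩ with hΦ
  have hcontr : ContractingWith (1 / 2) Φ := by
    refine ⟨by norm_num, LipschitzWith.of_dist_le_mul fun w w' => ?_⟩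
    refine (ContinuousMap.dist_le (by positivity)).2 fun t => ?_
    have ht := t.2
    have hpt : ∀ τ ∈ Set.Icc (t : ℝ) T, ‖f τ (lift w τ) - f τ (lift w' τ)‖
        ≤ K * dist w w' * Real.exp (2 * K * (T - τ)) := by
      intro τ hτ
      refine (hlip τ ⟨ht.1.trans hτ.1, hτ.2⟩ _ _).trans ?_
      simp only [hlift]
      rw [← smul_sub, norm_smul, Real.norm_eq_abs, abs_of_pos (Real.exp_pos _), ← dist_eq_norm]
      have := ContinuousMap.dist_apply_le_dist (f := w) (g := w') (Set.projIcc 0 T hT τ)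
      have h2 := (Real.exp_pos (2 * K * (T - τ))).le
      calc _ ≤ K * (Real.exp (2 * K * (T - τ)) * dist w w') := by gcongr
        _ = _ := by ring
    have hexp : ∫ τ in (t : ℝ)..T, K * dist w w' * Real.exp (2 * K * (T - τ))
        = dist w w' / 2 * (Real.exp (2 * K * (T - t)) - 1) := by
      have hd : ∀ τ ∈ Set.uIcc (t : ℝ) T, HasDerivAt
          (fun τ => -(dist w w' / 2) * Real.exp (2 * K * (T - τ)))
          (K * dist w w' * Real.exp (2 * K * (T - τ))) τ := fun τ _ => by
        have h1 : HasDerivAt (fun τ : ℝ => 2 * K * (T - τ)) (2 * K * (-1)) τ := by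
          simpa using ((hasDerivAt_id τ).const_sub T).const_mul (2 * K)
        have h2 := h1.exp.const_mul (-(dist w w' / 2))
        exact h2.congr_deriv (by ring)
      rw [intervalIntegral.integral_eq_sub_of_hasDerivAt hd
        (Continuous.intervalIntegrable (by fun_prop) _ _)]
      simp only [sub_self, mul_zero, Real.exp_zero]
      ring
    simp only [hΦ, ContinuousMap.coe_mk]
    rw [dist_eq_norm, ← smul_sub, add_sub_add_left_eq_sub,
      ← intervalIntegral.integral_sub (hsub ht hTT (hf _ (hliftc w)))
        (hsub ht hTT (hf _ (hliftc w'))), norm_smul, Real.norm_eq_abs, abs_of_pos (Real.exp_pos _)]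
    have h3 := intervalIntegral.norm_integral_le_of_norm_le (μ := volume) ht.2
      (Eventually.of_forall fun τ hτ => hpt τ (Set.Ioc_subset_Icc_self hτ))
      (Continuous.intervalIntegrable (by fun_prop) _ _)
    rw [hexp] at h3
    have h4 : Real.exp (-(2 * K * (T - t))) * Real.exp (2 * K * (T - t)) = 1 := by
      rw [← Real.exp_add]; simp
    have h5 := Real.exp_pos (-(2 * K * (T - (t : ℝ))))
    have h6 : 0 ≤ dist w w' := dist_nonneg
    calc _ ≤ Real.exp (-(2 * K * (T - t)))
          * (dist w w' / 2 * (Real.exp (2 * K * (T - t)) - 1)) := by gcongr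
      _ = dist w w' / 2 * (1 - Real.exp (-(2 * K * (T - t)))) := by
          linear_combination (dist w w' / 2) * h4
      _ ≤ dist w w' / 2 * 1 := by gcongr; linarith
      _ = _ := by simp; ring
  obtain ⟨w, hw⟩ : ∃ w, Φ w = w := ⟨_, hcontr.fixedPoint_isFixedPt⟩
  refine ⟨lift w, hliftc w, fun t ht => ?_⟩
  have h1 : w ⟨t, ht⟩ = Real.exp (-(2 * K * (T - t))) • (x + ∫ τ in t..T, f τ (lift w τ)) := by
    conv_lhs => rw [← hw]
    simp [hΦ]
  have h2 : lift w t = Real.exp (2 * K * (T - t)) • w ⟨t, ht⟩ := by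
    simp only [hlift, Set.projIcc_of_mem hT ht]
  rw [h2, h1, smul_smul, ← Real.exp_add]
  simp

/-- If `w` is negative at `t₁`, let `t₀` be the first later time at which it is nonnegative. On
`[t₁, t₀)` one has `h ≥ 0`, so `w t₁ ≥ w t₀ ≥ 0`, a contradiction. -/
theorem nonneg_of_backward_integral {w h : ℝ → ℝ} {T : ℝ} (hw : ContinuousOn w (Set.Icc 0 T))
    (hwT : 0 ≤ w T)
    (heq : ∀ a ∈ Set.Icc 0 T, ∀ b ∈ Set.Icc 0 T, w a = w b + ∫ t in a..b, h t)
    (hh : ∀ t ∈ Set.Icc 0 T, w t < 0 → 0 ≤ h t) : ∀ t ∈ Set.Icc 0 T, 0 ≤ w t := by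
  intro t₁ ht₁
  by_contra hneg
  have hsub : Set.Icc t₁ T ⊆ Set.Icc 0 T := Set.Icc_subset_Icc_left ht₁.1
  set S : Set ℝ := Set.Icc t₁ T ∩ w ⁻¹' Set.Ici 0 with hS
  have hSc : IsClosed S := (hw.mono hsub).preimage_isClosed_of_isClosed isClosed_Icc isClosed_Ici
  have hSn : S.Nonempty := ⟨T, ⟨ht₁.2, le_rfl⟩, hwT⟩
  have hSb : BddBelow S := ⟨t₁, fun t ht => ht.1.1⟩
  have h0 := hSc.csInf_mem hSn hSb
  set t₀ := sInf S with ht₀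
  have hint : 0 ≤ ∫ t in t₁..t₀, h t := by
    refine intervalIntegral.integral_nonneg_of_ae_restrict h0.1.1 ?_
    rw [EventuallyLE, ae_restrict_iff' measurableSet_Icc]
    have : ∀ᵐ t : ℝ, t ≠ t₀ := by simp [ae_iff, measure_singleton]
    filter_upwards [this] with t ht htm
    have htI : t ∈ Set.Icc t₁ T := ⟨htm.1, htm.2.trans h0.1.2⟩
    refine hh t (hsub htI) (not_le.1 fun h' => ?_)
    exact absurd (csInf_le hSb ⟨htI, h'⟩) (not_le.2 (lt_of_le_of_ne htm.2 ht))
  have := heq t₁ ht₁ t₀ (hsub h0.1)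
  have h1 : 0 ≤ w t₀ := h0.2
  exact hneg (by linarith)

/-! ### Bounded Lipschitz fields and clipping. -/

/-- A time-dependent function on `E` which is bounded and Lipschitz uniformly in time and measurable
in time along every continuous path. -/
structure IsBddLipschitzOn {E : Type*} [NormedAddCommGroup E] (T : ℝ) (f : ℝ → E → ℝ) : Prop where
  bdd : ∃ C : ℝ, ∀ t ∈ Set.Icc 0 T, ∀ u, |f t u| ≤ C
  lipschitz : ∃ K : ℝ, ∀ t ∈ Set.Icc 0 T, ∀ u v, |f t u - f t v| ≤ K * ‖u - v‖
  measurable : ∀ u : ℝ → E, Continuous u → BddMeasurableOn T fun t => f t (u t)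

namespace IsBddLipschitzOn

variable {E : Type*} [NormedAddCommGroup E] {T : ℝ} {f g : ℝ → E → ℝ}

theorem of_bddMeasurableOn {c : ℝ → ℝ} (hc : BddMeasurableOn T c) :
    IsBddLipschitzOn T fun t (_ : E) => c t :=
  ⟨hc.2.imp fun _ h t ht _ => h t ht, ⟨0, fun _ _ _ _ => by simp⟩, fun _ _ => hc⟩

theorem add (hf : IsBddLipschitzOn T f) (hg : IsBddLipschitzOn T g) :
    IsBddLipschitzOn T fun t u => f t u + g t u := by
  obtain ⟨⟨C, hC⟩, ⟨K, hK⟩, hm⟩ := hf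
  obtain ⟨⟨C', hC'⟩, ⟨K', hK'⟩, hm'⟩ := hg
  refine ⟨⟨C + C', fun t ht u => (abs_add_le _ _).trans (add_le_add (hC t ht u) (hC' t ht u))⟩,
    ⟨K + K', fun t ht u v => ?_⟩, fun u hu => (hm u hu).add (hm' u hu)⟩
  rw [add_sub_add_comm, add_mul]
  exact (abs_add_le _ _).trans (add_le_add (hK t ht u v) (hK' t ht u v))

theorem mul (hf : IsBddLipschitzOn T f) (hg : IsBddLipschitzOn T g) :
    IsBddLipschitzOn T fun t u => f t u * g t u := by
  obtain ⟨⟨C, hC⟩, ⟨K, hK⟩, hm⟩ := hf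
  obtain ⟨⟨C', hC'⟩, ⟨K', hK'⟩, hm'⟩ := hg
  refine ⟨⟨C * C', fun t ht u => ?_⟩,
    ⟨C * K' + C' * K, fun t ht u v => ?_⟩, fun u hu => (hm u hu).mul (hm' u hu)⟩
  · rw [abs_mul]
    exact mul_le_mul (hC t ht u) (hC' t ht u) (abs_nonneg _) ((abs_nonneg _).trans (hC t ht u))
  · have h : f t u * g t u - f t v * g t v
        = f t u * (g t u - g t v) + g t v * (f t u - f t v) := by ring
    rw [h, add_mul, mul_assoc, mul_assoc]
    refine (abs_add_le _ _).trans (add_le_add ?_ ?_) <;> rw [abs_mul]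
    · exact mul_le_mul (hC t ht u) (hK' t ht u v) (abs_nonneg _) ((abs_nonneg _).trans (hC t ht u))
    · exact mul_le_mul (hC' t ht v) (hK t ht u v) (abs_nonneg _) ((abs_nonneg _).trans (hC' t ht v))

theorem neg (hf : IsBddLipschitzOn T f) : IsBddLipschitzOn T fun t u => -f t u := by
  simpa using (of_bddMeasurableOn (BddMeasurableOn.const T (-1))).mul hf

theorem sub (hf : IsBddLipschitzOn T f) (hg : IsBddLipschitzOn T g) :
    IsBddLipschitzOn T fun t u => f t u - g t u := by
  simpa only [sub_eq_add_neg] using hf.add hg.neg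

theorem finset_sum {ι : Type*} (S : Finset ι) {f : ι → ℝ → E → ℝ}
    (hf : ∀ i, IsBddLipschitzOn T (f i)) : IsBddLipschitzOn T fun t u => ∑ i ∈ S, f i t u := by
  classical
  induction S using Finset.induction_on with
  | empty => simpa using of_bddMeasurableOn (BddMeasurableOn.const T 0)
  | insert a S ha ih =>
    simp only [Finset.sum_insert ha]
    exact (hf a).add ih

end IsBddLipschitzOn

/-- The value in `[0,M]` which is closest to `a`. -/
noncomputable def clip (M a : ℝ) : ℝ := max 0 (min a M)

theorem clip_nonneg (M a : ℝ) : 0 ≤ clip M a := le_max_left _ _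

theorem clip_le {M : ℝ} (hM : 0 ≤ M) (a : ℝ) : clip M a ≤ M := max_le hM (min_le_right _ _)

theorem clip_eq_self {M a : ℝ} (h0 : 0 ≤ a) (h1 : a ≤ M) : clip M a = a := by
  rw [clip, min_eq_left h1, max_eq_right h0]

theorem clip_of_nonpos {M a : ℝ} (h : a ≤ 0) : clip M a = 0 :=
  max_eq_left ((min_le_left _ _).trans h)

theorem clip_of_le {M a : ℝ} (hM : 0 ≤ M) (h : M ≤ a) : clip M a = M := by
  rw [clip, min_eq_right h, max_eq_right hM]

theorem isBddLipschitzOn_clip {n m : ℕ} {T : ℝ} {M : ℝ → ℝ} (hM : Continuous M)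
    (hM0 : ∀ t, 0 ≤ M t) (i : Fin n) (k : Fin m) :
    IsBddLipschitzOn T fun t (u : Fin n → Fin m → ℝ) => clip (M t) (u i k) := by
  refine ⟨?_, ⟨1, fun t _ u v => ?_⟩, fun u hu => BddMeasurableOn.of_continuousOn ?_⟩
  · obtain ⟨C, hC⟩ := isCompact_Icc.exists_bound_of_continuousOn (hM.continuousOn (s := Set.Icc 0 T))
    refine ⟨C, fun t ht u => ?_⟩
    rw [abs_of_nonneg (clip_nonneg _ _)]
    exact (clip_le (hM0 t) _).trans ((le_abs_self _).trans (hC t ht))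
  · have h1 : |u i k - v i k| ≤ ‖u - v‖ :=
      (norm_le_pi_norm (u i - v i) k).trans (norm_le_pi_norm (u - v) i)
    rw [one_mul]
    refine le_trans ?_ h1
    refine (abs_max_sub_max_le_max _ _ _ _).trans ?_
    rw [sub_self, abs_zero, max_eq_right (abs_nonneg _)]
    refine (abs_min_sub_min_le_max _ _ _ _).trans ?_
    rw [sub_self, abs_zero, max_eq_left (abs_nonneg _)]
  · refine Continuous.continuousOn ?_
    unfold clip
    fun_prop

/-! ### Solvability of the Riccati system. -/

namespace LogSquareGame

variable {n m : ℕ} {G : LogSquareGame n m}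

/-- The field is polynomial in the unknowns with bounded coefficients, and bounded Lipschitz
functions form an algebra. Boundedness of the entries is what tames the quadratic terms. -/
theorem isBddLipschitzOn_riccatiRHS {E : Type*} [NormedAddCommGroup E] (hcoeff : G.BddMeasurableCoeffs)
    {δ : ℝ} (hδ : 0 < δ) (hr : ∀ i, ∀ t ∈ Set.Icc 0 G.T, ∀ k, δ < G.r i t k)
    {A : Fin n → Fin m → ℝ → E → ℝ} (hA : ∀ i k, IsBddLipschitzOn G.T (A i k)) (i : Fin n)
    (k : Fin m) :
    IsBddLipschitzOn G.T fun t u => G.riccatiRHS (fun j τ l => A j l τ u) i t k := by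
  have hc : ∀ j, IsBddLipschitzOn G.T fun t (_ : E) => G.b₂ j t k ^ 2 / G.r j t k := fun j =>
    .of_bddMeasurableOn ((hcoeff.b₂ j k).pow_two.div (hcoeff.r j k) hδ fun t ht => hr j t ht k)
  have h2 : IsBddLipschitzOn G.T fun _ (_ : E) => (2 : ℝ) :=
    .of_bddMeasurableOn (BddMeasurableOn.const _ _)
  unfold riccatiRHS
  simp only [sq (A _ _ _ _)]
  refine IsBddLipschitzOn.sub (.add (.add (.sub (.neg (.of_bddMeasurableOn (hcoeff.q i k)))
    ((h2.mul (.of_bddMeasurableOn (hcoeff.b₁ k))).mul (hA i k)))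
    ((h2.mul (hA i k)).mul (.finset_sum _ fun j => (hA j k).mul (hc j))))
    (((hA i k).mul (hA i k)).mul (hc i))) (.finset_sum _ fun l => ?_)
  exact ((hA i l).sub (hA i k)).mul (.of_bddMeasurableOn (hcoeff.rate k l))

theorem bddMeasurableOn_riccatiRHS (hcoeff : G.BddMeasurableCoeffs)
    {δ : ℝ} (hδ : 0 < δ) (hr : ∀ i, ∀ t ∈ Set.Icc 0 G.T, ∀ k, δ < G.r i t k)
    {α : Fin n → ℝ → Fin m → ℝ} (hα : ∀ i k, BddMeasurableOn G.T fun t => α i t k) (i : Fin n)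
    (k : Fin m) : BddMeasurableOn G.T fun t => G.riccatiRHS α i t k :=
  -- The parameter space is a dummy: `α` is already a function of time alone.
  (isBddLipschitzOn_riccatiRHS (E := ℝ) hcoeff hδ hr (A := fun j l t _ => α j t l)
    (fun j l => .of_bddMeasurableOn (hα j l)) i k).measurable (fun _ => 0) continuous_const

theorem exists_isRiccatiSolution (hT : 0 < G.T) (hcoeff : G.BddMeasurableCoeffs)
    (hq : ∀ i, ∀ t ∈ Set.Icc 0 G.T, ∀ k, 0 ≤ G.q i t k)
    {δ : ℝ} (hδ : 0 < δ) (hr : ∀ i, ∀ t ∈ Set.Icc 0 G.T, ∀ k, δ < G.r i t k)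
    (hrate : ∀ t ∈ Set.Icc 0 G.T, ∀ k k', k ≠ k' → 0 < G.rate t k k') :
    ∃ α, G.IsRiccatiSolution α := by
  obtain ⟨Q, hQ0, hQ⟩ := exists_uniform_bound (S := Set.Icc 0 G.T)
    (f := fun (p : Fin n × Fin m) t => G.q p.1 t p.2) fun p => (hcoeff.q p.1 p.2).2
  obtain ⟨B, hB0, hB⟩ := exists_uniform_bound fun k => (hcoeff.b₁ k).2
  have hTT : G.T ∈ Set.Icc 0 G.T := ⟨hT.le, le_rfl⟩
  have h0T : (0 : ℝ) ∈ Set.Icc 0 G.T := ⟨le_rfl, hT.le⟩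
  -- `M` is an upper barrier: at `αᵢ = M` the field is at most `Q + 2 B M ≤ c M`, as `Q ≤ M`, while
  -- the quadratic and switching terms only help.
  set c : ℝ := 2 * B + 1 with hc
  set M : ℝ → ℝ := fun t => (Q + 1) * Real.exp (c * (G.T - t)) with hM
  have hMc : Continuous M := by fun_prop
  have hM0 : ∀ t, 0 ≤ M t := fun t => by positivity
  set A : Fin n → Fin m → ℝ → (Fin n → Fin m → ℝ) → ℝ := fun i k t u => clip (M t) (u i k) with hA
  set F : Fin n → Fin m → ℝ → (Fin n → Fin m → ℝ) → ℝ := fun i k t u =>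
    -G.riccatiRHS (fun j τ l => A j l τ u) i t k with hF
  have hFL : ∀ i k, IsBddLipschitzOn G.T (F i k) := fun i k =>
    (isBddLipschitzOn_riccatiRHS hcoeff hδ hr (fun i k => isBddLipschitzOn_clip hMc hM0 i k) i k).neg
  obtain ⟨K, hK0, hK⟩ : ∃ K : ℝ, 0 < K ∧ ∀ i k, ∀ t ∈ Set.Icc 0 G.T, ∀ u v,
      |F i k t u - F i k t v| ≤ K * ‖u - v‖ := by
    choose K hK using fun i k => (hFL i k).lipschitz
    refine ⟨1 + ∑ p : Fin n × Fin m, |K p.1 p.2|, by positivity, fun i k t ht u v => ?_⟩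
    refine (hK i k t ht u v).trans (mul_le_mul_of_nonneg_right ?_ (norm_nonneg _))
    have := Finset.single_le_sum (f := fun p : Fin n × Fin m => |K p.1 p.2|)
      (fun p _ => abs_nonneg _) (Finset.mem_univ (i, k))
    exact (le_abs_self _).trans (by simp only at this; linarith)
  have hFint : ∀ u : ℝ → Fin n → Fin m → ℝ, Continuous u →
      IntervalIntegrable (fun t i k => F i k t (u t)) volume 0 G.T := by
    intro u hu
    rw [intervalIntegrable_iff]
    refine Integrable.of_eval fun i => Integrable.of_eval fun k => ?_
    exact intervalIntegrable_iff.1 (((hFL i k).measurable u hu).intervalIntegrable h0T hTT)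
  obtain ⟨u, huc, hu⟩ := exists_backward_integral_solution hT.le hK0
    (f := fun t u i k => F i k t u) hFint (fun t ht u v => by
      refine (pi_norm_le_iff_of_nonneg (by positivity)).2 fun i =>
        (pi_norm_le_iff_of_nonneg (by positivity)).2 fun k => hK i k t ht u v)
    (fun i k => G.q i G.T k)
  have huik : ∀ i k, ∀ t ∈ Set.Icc 0 G.T,
      u t i k = G.q i G.T k + ∫ τ in t..G.T, F i k τ (u τ) := by
    intro i k t ht
    have h1 := ((ContinuousLinearMap.proj (R := ℝ) (φ := fun _ : Fin m => ℝ) k).comp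
      (ContinuousLinearMap.proj (R := ℝ) (φ := fun _ : Fin n => Fin m → ℝ) i)
      ).intervalIntegral_comp_comm ((hFint u huc).mono_set
        ((Set.uIcc_subset_Icc ht hTT).trans (Set.uIcc_of_le hT.le).ge))
    simp only [ContinuousLinearMap.coe_comp, Function.comp, ContinuousLinearMap.proj_apply] at h1
    rw [h1]
    conv_lhs => rw [hu t ht]
    rfl
  have hFi : ∀ i k, ∀ a ∈ Set.Icc 0 G.T, ∀ b ∈ Set.Icc 0 G.T,
      IntervalIntegrable (fun τ => F i k τ (u τ)) volume a b := fun i k a ha b hb =>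
    ((hFL i k).measurable u huc).intervalIntegrable ha hb
  have hincr : ∀ i k, ∀ a ∈ Set.Icc 0 G.T, ∀ b ∈ Set.Icc 0 G.T,
      u a i k = u b i k + ∫ τ in a..b, F i k τ (u τ) := by
    intro i k a ha b hb
    rw [huik i k a ha, huik i k b hb, ← intervalIntegral.integral_add_adjacent_intervals
      (hFi i k a ha b hb) (hFi i k b hb _ hTT)]
    ring
  have huikc : ∀ i k, Continuous fun t => u t i k := fun i k => by fun_prop
  have hcoef : ∀ j, ∀ t ∈ Set.Icc 0 G.T, ∀ k, 0 ≤ G.b₂ j t k ^ 2 / G.r j t k := fun j t ht k =>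
    div_nonneg (sq_nonneg _) (hδ.trans (hr j t ht k)).le
  have hnonneg : ∀ i k, ∀ t ∈ Set.Icc 0 G.T, 0 ≤ u t i k := by
    intro i k
    refine nonneg_of_backward_integral (huikc i k).continuousOn ?_ (hincr i k) fun t ht hneg => ?_
    · rw [huik i k _ hTT]; simpa using hq i _ hTT k
    -- Below zero every term containing the clipped `αᵢ(t,k)` as a factor vanishes; only `q` and
    -- inflow from the other regimes remain, both nonnegative.
    · have h0 : A i k t (u t) = 0 := clip_of_nonpos hneg.le
      simp only [hF, riccatiRHS, h0]
      have h1 : 0 ≤ ∑ l, (A i l t (u t) - 0) * G.rate t k l := by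
        refine Finset.sum_nonneg fun l _ => ?_
        by_cases hl : l = k
        · rw [hl, h0]; simp
        · rw [sub_zero]
          exact mul_nonneg (clip_nonneg _ _) (hrate t ht k l (Ne.symm hl)).le
      have h2 := hq i t ht k
      simp only [mul_zero, zero_mul, sub_zero, add_zero, ne_eq, OfNat.ofNat_ne_zero,
        not_false_eq_true, zero_pow] at h1 ⊢
      linarith
  have hle : ∀ i k, ∀ t ∈ Set.Icc 0 G.T, u t i k ≤ M t := by
    intro i k
    have hMd : ∀ a b, M a = M b + ∫ τ in a..b, c * M τ := by
      intro a b
      have hd : ∀ τ ∈ Set.uIcc a b, HasDerivAt (fun τ => -M τ) (c * M τ) τ := fun τ _ => by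
        have h1 : HasDerivAt (fun τ : ℝ => c * (G.T - τ)) (c * (-1)) τ := by
          simpa using ((hasDerivAt_id τ).const_sub G.T).const_mul c
        have h2 := (h1.exp.const_mul (Q + 1)).neg
        exact h2.congr_deriv (by ring)
      rw [intervalIntegral.integral_eq_sub_of_hasDerivAt hd
        (Continuous.intervalIntegrable (by fun_prop) _ _)]
      ring
    have hmain := nonneg_of_backward_integral (T := G.T) (w := fun t => M t - u t i k)
      (h := fun t => c * M t - F i k t (u t)) (hMc.sub (huikc i k)).continuousOn ?_ ?_ ?_
    · exact fun t ht => sub_nonneg.1 (hmain t ht)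
    · rw [huik i k _ hTT]
      have h1 := (le_abs_self _).trans (hQ (i, k) _ hTT)
      have h2 : M G.T = Q + 1 := by simp [hM]
      simp only [intervalIntegral.integral_same, add_zero, h2] at h1 ⊢
      linarith
    · intro a ha b hb
      rw [intervalIntegral.integral_sub (Continuous.intervalIntegrable (by fun_prop) _ _)
        (hFi i k a ha b hb)]
      have h1 := hMd a b
      have h2 := hincr i k a ha b hb
      linarith
    · intro t ht hneg
      have h0 : A i k t (u t) = M t := clip_of_le (hM0 t) (by linarith)
      simp only [hF, riccatiRHS, h0]
      have h1 : ∑ l, (A i l t (u t) - M t) * G.rate t k l ≤ 0 := by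
        refine Finset.sum_nonpos fun l _ => ?_
        by_cases hl : l = k
        · rw [hl, h0]; simp
        · exact mul_nonpos_of_nonpos_of_nonneg (sub_nonpos.2 (clip_le (hM0 t) _))
            (hrate t ht k l (Ne.symm hl)).le
      have h2 : 0 ≤ ∑ j ∈ Finset.univ.erase i, A j k t (u t) * (G.b₂ j t k ^ 2 / G.r j t k) :=
        Finset.sum_nonneg fun j _ => mul_nonneg (clip_nonneg _ _) (hcoef j t ht k)
      have h3 := (le_abs_self _).trans (hQ (i, k) t ht)
      have h4 := (le_abs_self _).trans (hB k t ht)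
      have h5 : Q + 1 ≤ M t := by
        have : 0 ≤ c * (G.T - t) := mul_nonneg (by positivity) (by linarith [ht.2])
        have := Real.one_le_exp this
        simp only [hM]; nlinarith
      have h6 := mul_nonneg (hM0 t) h2
      have h7 := mul_nonneg (sq_nonneg (M t)) (hcoef i t ht k)
      have h8 : G.b₁ t k * M t ≤ B * M t := mul_le_mul_of_nonneg_right h4 (hM0 t)
      simp only [hc] at h3 ⊢
      nlinarith
  refine ⟨fun i t k => u t i k, fun i k => ⟨(huikc i k).continuousOn, fun t ht => ?_⟩⟩
  beta_reduce
  rw [huik i k t ht, sub_eq_add_neg, ← intervalIntegral.integral_neg]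
  congr 1
  refine intervalIntegral.integral_congr fun τ hτ => ?_
  have hτ' : τ ∈ Set.Icc 0 G.T := Set.uIcc_subset_Icc ht hTT hτ
  have hAu : ∀ j l, A j l τ (u τ) = u τ j l := fun j l =>
    clip_eq_self (hnonneg j l τ hτ') (hle j l τ hτ')
  simp only [hF, riccatiRHS, hAu]

end LogSquareGame

/-! ### Integrability in time and on the product space. -/

theorem IsRegimeSwitching.intervalIntegrable_mul {Ω : Type*} {mΩ : MeasurableSpace Ω} {m : ℕ}
    {μ : Measure Ω} {ℱ : Filtration ℝ mΩ} {T : ℝ} {rate : ℝ → Fin m → Fin m → ℝ}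
    {s : ℝ → Ω → Fin m} (hs : IsRegimeSwitching μ ℱ T rate s) (hT : 0 < T) {h : ℝ → Fin m → ℝ}
    (hh : ∀ k, BddMeasurableOn T fun t => h t k) (ω : Ω) {f : ℝ → ℝ}
    (hf : IntervalIntegrable f volume 0 T) :
    IntervalIntegrable (fun t => h t (s t ω) * f t) volume 0 T := by
  obtain ⟨C, -, hC⟩ := exists_uniform_bound fun k => (hh k).2
  have h1 := hs.intervalIntegrable hT hh ω
  rw [intervalIntegrable_iff_integrableOn_Ioc_of_le hT.le] at h1 hf ⊢
  refine hf.bdd_mul (c := C) h1.aestronglyMeasurable ?_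
  rw [ae_restrict_iff' measurableSet_Ioc]
  exact Eventually.of_forall fun t ht => hC _ t (Set.Ioc_subset_Icc_self ht)

theorem intervalIntegral_eq_integral_restrict_Icc {T : ℝ} (hT : 0 ≤ T) (f : ℝ → ℝ) :
    ∫ t in (0 : ℝ)..T, f t = ∫ t, f t ∂(volume.restrict (Set.Icc 0 T)) := by
  rw [intervalIntegral.integral_of_le hT, integral_Icc_eq_integral_Ioc]

section ProductMeasure

variable {Ω : Type*} {mΩ : MeasurableSpace Ω} {μ : Measure Ω} {T : ℝ}

theorem integrable_intervalIntegral_of_prod [SFinite μ] (hT : 0 ≤ T) {f : ℝ → Ω → ℝ}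
    (hf : Integrable (fun p : ℝ × Ω => f p.1 p.2) ((volume.restrict (Set.Icc 0 T)).prod μ)) :
    Integrable (fun ω => ∫ t in (0 : ℝ)..T, f t ω) μ := by
  simp_rw [intervalIntegral_eq_integral_restrict_Icc hT]
  exact hf.integral_prod_right

theorem ae_intervalIntegrable_of_prod [SFinite μ] (hT : 0 ≤ T) {f : ℝ → Ω → ℝ}
    (hf : Integrable (fun p : ℝ × Ω => f p.1 p.2) ((volume.restrict (Set.Icc 0 T)).prod μ)) :
    ∀ᵐ ω ∂μ, IntervalIntegrable (fun t => f t ω) volume 0 T := by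
  filter_upwards [hf.prod_left_ae] with ω h
  rwa [intervalIntegrable_iff_integrableOn_Icc_of_le hT]

theorem ae_prod_restrict_Icc {P : ℝ → Ω → Prop} (h : ∀ᵐ ω ∂μ, ∀ t ∈ Set.Icc 0 T, P t ω) :
    ∀ᵐ p ∂((volume.restrict (Set.Icc 0 T)).prod μ), p.1 ∈ Set.Icc 0 T ∧ P p.1 p.2 := by
  have h1 : ∀ᵐ t ∂(volume.restrict (Set.Icc 0 T)), t ∈ Set.Icc 0 T :=
    ae_restrict_mem measurableSet_Icc
  filter_upwards [Measure.quasiMeasurePreserving_fst.ae h1,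
    Measure.quasiMeasurePreserving_snd.ae h] with p hp1 hp2 using ⟨hp1, hp2 p.1 hp1⟩

end ProductMeasure

/-! ### The logarithm of the state and the cost identity. -/

namespace LogSquareGame

variable {n m : ℕ} {G : LogSquareGame n m} {Ω : Type*} {mΩ : MeasurableSpace Ω} {μ : Measure Ω}
  {ℱ : Filtration ℝ mΩ} {s : ℝ → Ω → Fin m} {γ : Fin n → ℝ → Ω → ℝ → ℝ} {x : ℝ → Ω → ℝ}

/-- The drift of the logarithm of the state. -/
noncomputable def logDrift (G : LogSquareGame n m) (s : ℝ → Ω → Fin m) (γ : Fin n → ℝ → Ω → ℝ → ℝ)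
    (x : ℝ → Ω → ℝ) (t : ℝ) (ω : Ω) : ℝ :=
  G.b₁ t (s t ω) * Real.log (x t ω) + ∑ j, G.b₂ j t (s t ω) * control γ x j t ω

theorem IsState.integrable_control_sq [IsProbabilityMeasure μ] (hx : G.IsState μ ℱ s γ x)
    (j : Fin n) : Integrable (fun p : ℝ × Ω => control γ x j p.1 p.2 ^ 2)
      ((volume.restrict (Set.Icc 0 G.T)).prod μ) :=
  (hx.admissible j).square_integrable.integrable_sq

theorem IsState.integrable_control [IsProbabilityMeasure μ] (hx : G.IsState μ ℱ s γ x)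
    (j : Fin n) : Integrable (fun p : ℝ × Ω => control γ x j p.1 p.2)
      ((volume.restrict (Set.Icc 0 G.T)).prod μ) :=
  (hx.admissible j).square_integrable.integrable (by norm_num)

theorem IsState.ae_log_eq [IsProbabilityMeasure μ] (hT : 0 < G.T) (hcoeff : G.BddMeasurableCoeffs)
    (hs : IsRegimeSwitching μ ℱ G.T G.rate s) (hx : G.IsState μ ℱ s γ x) :
    ∀ᵐ ω ∂μ, x 0 ω = G.x₀ ∧ ContinuousOn (fun t => Real.log (x t ω)) (Set.Icc 0 G.T) ∧
      IntervalIntegrable (fun t => G.logDrift s γ x t ω) volume 0 G.T ∧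
      ∀ t ∈ Set.Icc 0 G.T, Real.log (x t ω) = Real.log (x 0 ω)
        + ∫ τ in (0 : ℝ)..t, G.logDrift s γ x τ ω := by
  have hu : ∀ᵐ ω ∂μ, ∀ j, IntervalIntegrable (fun t => control γ x j t ω) volume 0 G.T :=
    ae_all_iff.2 fun j => ae_intervalIntegrable_of_prod hT.le (hx.integrable_control j)
  have h0T : (0 : ℝ) ∈ Set.Icc 0 G.T := ⟨le_rfl, hT.le⟩
  filter_upwards [hx.continuous, hx.positive, hx.dynamics, hu] with ω hc hp hd hu
  have huIcc : Set.uIcc 0 G.T = Set.Icc 0 G.T := Set.uIcc_of_le hT.le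
  have hlog : ContinuousOn (fun t => Real.log (x t ω)) (Set.Icc 0 G.T) :=
    hc.log fun t ht => (hp t ht).ne'
  have hb₂ : IntervalIntegrable (fun t => ∑ j, G.b₂ j t (s t ω) * control γ x j t ω)
      volume 0 G.T := by
    have := IntervalIntegrable.sum (Finset.univ) fun j _ =>
      hs.intervalIntegrable_mul hT (hcoeff.b₂ j) ω (hu j)
    simpa only [Finset.sum_fn] using this
  have hdrift : IntervalIntegrable (fun t => G.logDrift s γ x t ω) volume 0 G.T :=
    ((hs.intervalIntegrable hT hcoeff.b₁ ω).mul_continuousOn (huIcc ▸ hlog)).add hb₂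
  have hx0 : x 0 ω = G.x₀ := by simpa using hd 0 h0T
  refine ⟨hx0, hlog, hdrift, ?_⟩
  have hint : IntervalIntegrable (fun t => x t ω * G.logDrift s γ x t ω) volume 0 G.T :=
    hdrift.continuousOn_mul (huIcc ▸ hc)
  have hd' : ∀ t ∈ Set.Icc 0 G.T, x t ω = x 0 ω
      + ∫ τ in (0 : ℝ)..t, x τ ω * G.logDrift s γ x τ ω := by
    intro t ht
    rw [hd t ht, hx0]
    congr 2
    funext τ
    simp only [logDrift, mul_add, Finset.mul_sum]
    congr 1
    · ring
    · exact Finset.sum_congr rfl fun j _ => by ring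
  -- The path stays above a positive minimum, and on that half-line `log` is Lipschitz.
  obtain ⟨t₀, ht₀, hmin⟩ := isCompact_Icc.exists_isMinOn ⟨0, h0T⟩ hc
  have hpos := hp t₀ ht₀
  have key := comp_eq_add_integral (φ := Real.log) (φ' := fun z => z⁻¹) (K := (x t₀ ω)⁻¹)
    (S := Set.Ici (x t₀ ω)) hT.le (convex_Ici _)
    (fun z hz => Real.hasDerivAt_log (hpos.trans_le hz).ne')
    (fun z hz => by
      rw [abs_of_pos (inv_pos.2 (hpos.trans_le hz))]
      exact inv_anti₀ hpos hz)
    (fun t ht => hmin ht) hint hd'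
  intro t ht
  rw [key t ht]
  congr 1
  refine intervalIntegral.integral_congr fun τ hτ => ?_
  have hτ' : τ ∈ Set.Icc 0 G.T := Set.uIcc_subset_Icc h0T ht hτ
  simp only
  rw [← mul_assoc, inv_mul_cancel₀ (hp τ hτ').ne', one_mul]

/-- With `y = ln x`, the bound `2 |b₂ y u| ≤ b₂² y² + u²` gives `|(y²)'| ≤ K y² + ∑ⱼ uⱼ²`. Grönwall
then dominates `y²` by the total control energy, which is integrable by admissibility. These are the
majorants needed for `integral_dynkin`. -/
theorem IsState.exists_integrable_bound [IsProbabilityMeasure μ] (hT : 0 < G.T)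
    (hcoeff : G.BddMeasurableCoeffs) (hs : IsRegimeSwitching μ ℱ G.T G.rate s)
    (hx : G.IsState μ ℱ s γ x) :
    ∃ D D' : Ω → ℝ, Integrable D μ ∧ Integrable D' μ ∧ ∀ᵐ ω ∂μ,
      IntervalIntegrable (fun t => 2 * Real.log (x t ω) * G.logDrift s γ x t ω) volume 0 G.T ∧
      (∀ t ∈ Set.Icc 0 G.T, Real.log (x t ω) ^ 2 = Real.log (x 0 ω) ^ 2
        + ∫ τ in (0 : ℝ)..t, 2 * Real.log (x τ ω) * G.logDrift s γ x τ ω) ∧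
      (∀ t ∈ Set.Icc 0 G.T, |Real.log (x t ω) ^ 2| ≤ D ω) ∧
      ∫ t in (0 : ℝ)..G.T, |2 * Real.log (x t ω) * G.logDrift s γ x t ω| ≤ D' ω := by
  obtain ⟨B₁, hB₁0, hB₁⟩ := exists_uniform_bound fun k => (hcoeff.b₁ k).2
  obtain ⟨B₂, hB₂0, hB₂⟩ := exists_uniform_bound (S := Set.Icc 0 G.T)
    (f := fun (p : Fin n × Fin m) t => G.b₂ p.1 t p.2) fun p => (hcoeff.b₂ p.1 p.2).2
  set K : ℝ := 2 * B₁ + n * B₂ ^ 2 with hK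
  have hK0 : 0 ≤ K := by positivity
  set W : Ω → ℝ := fun ω => ∫ t in (0 : ℝ)..G.T, ∑ j, control γ x j t ω ^ 2 with hW
  have hsum : Integrable (fun p : ℝ × Ω => ∑ j, control γ x j p.1 p.2 ^ 2)
      ((volume.restrict (Set.Icc 0 G.T)).prod μ) :=
    integrable_finsetSum _ fun j _ => hx.integrable_control_sq j
  have hWi : Integrable W μ := integrable_intervalIntegral_of_prod hT.le
    (f := fun t ω => ∑ j, control γ x j t ω ^ 2) hsum
  set D : Ω → ℝ := fun ω => Real.exp (K * G.T) * (Real.log G.x₀ ^ 2 + W ω) with hD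
  have hDi : Integrable D μ := ((integrable_const _).add hWi).const_mul _
  refine ⟨D, fun ω => K * D ω * G.T + W ω, hDi, ((hDi.const_mul K).mul_const _).add hWi, ?_⟩
  have hw := ae_intervalIntegrable_of_prod hT.le (f := fun t ω => ∑ j, control γ x j t ω ^ 2) hsum
  filter_upwards [hx.ae_log_eq hT hcoeff hs, hw] with ω ⟨hx0, hlog, hdrift, heq⟩ hw
  have huIcc : Set.uIcc 0 G.T = Set.Icc 0 G.T := Set.uIcc_of_le hT.le
  have hζ : IntervalIntegrable (fun t => 2 * Real.log (x t ω) * G.logDrift s γ x t ω)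
      volume 0 G.T :=
    hdrift.continuousOn_mul (huIcc ▸ (continuousOn_const.mul hlog))
  obtain ⟨C, hC⟩ := isCompact_Icc.exists_bound_of_continuousOn hlog
  have hZ : ∀ t ∈ Set.Icc 0 G.T, Real.log (x t ω) ^ 2 = Real.log (x 0 ω) ^ 2
        + ∫ τ in (0 : ℝ)..t, 2 * Real.log (x τ ω) * G.logDrift s γ x τ ω :=
    comp_eq_add_integral (φ := fun z => z ^ 2) (φ' := fun z => 2 * z) (K := 2 * C)
      (S := Set.Icc (-C) C) (y := fun t => Real.log (x t ω)) hT.le (convex_Icc _ _)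
      (fun z _ => by simpa using hasDerivAt_pow 2 z)
      (fun z hz => by
        rw [abs_mul, abs_two]
        exact mul_le_mul_of_nonneg_left (abs_le.2 hz) zero_le_two)
      (fun t ht => abs_le.1 (hC t ht)) hdrift heq
  have hle : ∀ t ∈ Set.Icc 0 G.T, |2 * Real.log (x t ω) * G.logDrift s γ x t ω|
      ≤ K * Real.log (x t ω) ^ 2 + ∑ j, control γ x j t ω ^ 2 := by
    intro t ht
    set y := Real.log (x t ω) with hy
    have h1 : 2 * y * G.logDrift s γ x t ω = 2 * G.b₁ t (s t ω) * y ^ 2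
        + ∑ j, 2 * (G.b₂ j t (s t ω) * y) * control γ x j t ω := by
      simp only [logDrift, mul_add, Finset.mul_sum]
      congr 1
      · ring
      · exact Finset.sum_congr rfl fun j _ => by ring
    have h2 : |2 * G.b₁ t (s t ω) * y ^ 2| ≤ 2 * B₁ * y ^ 2 := by
      rw [abs_mul, abs_mul, abs_two, abs_of_nonneg (sq_nonneg y)]
      have := hB₁ (s t ω) t ht
      gcongr
    have h3 : ∀ j, |2 * (G.b₂ j t (s t ω) * y) * control γ x j t ω|
        ≤ B₂ ^ 2 * y ^ 2 + control γ x j t ω ^ 2 := by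
      intro j
      have h4 : (G.b₂ j t (s t ω)) ^ 2 ≤ B₂ ^ 2 :=
        sq_le_sq' (neg_le_of_abs_le (hB₂ (j, s t ω) t ht)) (le_of_abs_le (hB₂ (j, s t ω) t ht))
      have h5 := mul_le_mul_of_nonneg_right h4 (sq_nonneg y)
      refine abs_le.2 ⟨?_, ?_⟩
      · nlinarith [sq_nonneg (G.b₂ j t (s t ω) * y + control γ x j t ω)]
      · nlinarith [sq_nonneg (G.b₂ j t (s t ω) * y - control γ x j t ω)]
    rw [h1]
    refine (abs_add_le _ _).trans ((add_le_add h2 ((Finset.abs_sum_le_sum_abs _ _).trans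
      (Finset.sum_le_sum fun j _ => h3 j))).trans_eq ?_)
    rw [Finset.sum_add_distrib]
    simp [hK]
    ring
  have hDle : ∀ t ∈ Set.Icc 0 G.T, Real.log (x t ω) ^ 2 ≤ D ω := by
    have := le_exp_mul_of_integral_le (v := fun t => Real.log (x t ω) ^ 2) hT.le hK0 hζ hw
      (fun t _ => Finset.sum_nonneg fun j _ => sq_nonneg _) (sq_nonneg _) hZ
      fun t ht => (le_abs_self _).trans (hle t ht)
    simpa only [hx0] using this
  refine ⟨hζ, hZ, fun t ht => (abs_of_nonneg (sq_nonneg _)).trans_le (hDle t ht), ?_⟩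
  calc _ ≤ ∫ t in (0 : ℝ)..G.T, (K * D ω + ∑ j, control γ x j t ω ^ 2) := by
        refine intervalIntegral.integral_mono_on hT.le hζ.abs
          (intervalIntegrable_const.add hw) fun t ht => (hle t ht).trans ?_
        have := hDle t ht
        gcongr
    _ = _ := by
        rw [intervalIntegral.integral_add intervalIntegrable_const hw]
        simp [hW]; ring

theorem IsRiccatiSolution.terminal {α : Fin n → ℝ → Fin m → ℝ} (hT : 0 ≤ G.T)
    (hα : G.IsRiccatiSolution α) (i : Fin n) (k : Fin m) : α i G.T k = G.q i G.T k := by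
  simpa using (hα i k).2 G.T ⟨hT, le_rfl⟩

theorem IsRiccatiSolution.bddMeasurableOn {α : Fin n → ℝ → Fin m → ℝ}
    (hα : G.IsRiccatiSolution α) (i : Fin n) (k : Fin m) :
    BddMeasurableOn G.T fun t => α i t k :=
  .of_continuousOn (hα i k).1

theorem IsRiccatiSolution.sub_eq {α : Fin n → ℝ → Fin m → ℝ} (hcoeff : G.BddMeasurableCoeffs)
    {δ : ℝ} (hδ : 0 < δ) (hr : ∀ i, ∀ t ∈ Set.Icc 0 G.T, ∀ k, δ < G.r i t k)
    (hα : G.IsRiccatiSolution α) (i : Fin n) (k : Fin m) :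
    ∀ a ∈ Set.Icc 0 G.T, ∀ b ∈ Set.Icc 0 G.T,
      α i b k - α i a k = ∫ t in a..b, G.riccatiRHS α i t k := by
  intro a ha b hb
  have hTT : G.T ∈ Set.Icc 0 G.T := ⟨ha.1.trans ha.2, le_rfl⟩
  have hbm := bddMeasurableOn_riccatiRHS hcoeff hδ hr hα.bddMeasurableOn i k
  rw [(hα i k).2 a ha, (hα i k).2 b hb, ← intervalIntegral.integral_add_adjacent_intervals
    (hbm.intervalIntegrable ha hb) (hbm.intervalIntegrable hb hTT)]
  ring

theorem IsState.aestronglyMeasurable_log [IsProbabilityMeasure μ] (hT : 0 < G.T)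
    (hx : G.IsState μ ℱ s γ x) :
    AEStronglyMeasurable (fun p : ℝ × Ω => Real.log (x p.1 p.2))
      ((volume.restrict (Set.Icc 0 G.T)).prod μ) := by
  refine aestronglyMeasurable_uncurry_of_right_continuous (f := fun t ω => Real.log (x t ω)) hT
    (fun t ht => ((hx.adapted t ht).mono (ℱ.le t) le_rfl).log) ?_
  filter_upwards [hx.continuous, hx.positive] with ω hc hp t ht
  have h1 := hc.log (fun t ht => (hp t ht).ne') t (Set.Ico_subset_Icc_self ht)
  exact h1.tendsto.mono_left (nhdsWithin_le_of_mem (Icc_mem_nhdsGT_of_mem ht))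

/-- Completion of the square with value function `αᵢ ln² x`. The strategy of player `i` is left
free, so the identity covers both the equilibrium and every unilateral deviation from it. -/
theorem IsState.integral_cost [IsProbabilityMeasure μ] (hT : 0 < G.T)
    (hcoeff : G.BddMeasurableCoeffs) {δ : ℝ} (hδ : 0 < δ)
    (hr : ∀ i, ∀ t ∈ Set.Icc 0 G.T, ∀ k, δ < G.r i t k)
    (hs : IsRegimeSwitching μ ℱ G.T G.rate s) {α : Fin n → ℝ → Fin m → ℝ}
    (hα : G.IsRiccatiSolution α) (hx : G.IsState μ ℱ s γ x) (i : Fin n)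
    (hγ : ∀ j, j ≠ i → γ j = G.feedback s α j) :
    Integrable (G.cost s i x (control γ x i)) μ ∧
    ∫ ω, G.cost s i x (control γ x i) ω ∂μ
      = ∫ ω, α i 0 (s 0 ω) * Real.log G.x₀ ^ 2 ∂μ
        + ∫ ω, (∫ t in (0 : ℝ)..G.T, G.r i t (s t ω) *
          (control γ x i t ω - G.feedback s α i t ω (x t ω)) ^ 2) ∂μ := by
  have h0T : (0 : ℝ) ∈ Set.Icc 0 G.T := ⟨le_rfl, hT.le⟩
  have hTT : G.T ∈ Set.Icc 0 G.T := ⟨hT.le, le_rfl⟩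
  obtain ⟨D, D', hD, hD', hae⟩ := hx.exists_integrable_bound hT hcoeff hs
  have hZm : ∀ t ∈ Set.Icc 0 G.T, Measurable[ℱ t] fun ω => Real.log (x t ω) ^ 2 := fun t ht =>
    (Real.measurable_log.comp (hx.adapted t ht)).pow_const 2
  have hdyn := hs.integral_dynkin hT hcoeff.rate
    (g := fun t k => α i t k) (g' := fun t k => G.riccatiRHS α i t k)
    (bddMeasurableOn_riccatiRHS hcoeff hδ hr hα.bddMeasurableOn i) (fun k => (hα i k).1)
    (hα.sub_eq hcoeff hδ hr i) hZm
    (hae.mono fun ω h => h.1) (hae.mono fun ω h => h.2.1) hD (hae.mono fun ω h => h.2.2.1)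
    hD' (hae.mono fun ω h => h.2.2.2)
  set L : Ω → ℝ → ℝ := fun ω t => G.riccatiRHS α i t (s t ω) * Real.log (x t ω) ^ 2
      + (∑ k, (α i t k - α i t (s t ω)) * G.rate t (s t ω) k) * Real.log (x t ω) ^ 2
      + α i t (s t ω) * (2 * Real.log (x t ω) * G.logDrift s γ x t ω) with hL
  set R : ℝ → Ω → ℝ := fun t ω => G.r i t (s t ω) *
      (control γ x i t ω - G.feedback s α i t ω (x t ω)) ^ 2 with hR
  set κ : ℝ → Fin m → ℝ := fun t k => α i t k * G.b₂ i t k / G.r i t k with hκ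
  have hκm : ∀ k, BddMeasurableOn G.T fun t => κ t k := fun k =>
    ((hα.bddMeasurableOn i k).mul (hcoeff.b₂ i k)).div (hcoeff.r i k) hδ fun t ht => hr i t ht k
  have hRi : Integrable (fun p : ℝ × Ω => R p.1 p.2) ((volume.restrict (Set.Icc 0 G.T)).prod μ) := by
    obtain ⟨Cr, hCr0, hCr⟩ := exists_uniform_bound fun k => (hcoeff.r i k).2
    obtain ⟨Cκ, hCκ0, hCκ⟩ := exists_uniform_bound fun k => (hκm k).2
    have hm : AEStronglyMeasurable (fun p : ℝ × Ω => R p.1 p.2)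
        ((volume.restrict (Set.Icc 0 G.T)).prod μ) := by
      refine (hs.aestronglyMeasurable hT (hcoeff.r i)).mul
        (AEStronglyMeasurable.pow ((hx.integrable_control i).aestronglyMeasurable.sub ?_) 2)
      exact (hs.aestronglyMeasurable hT hκm).neg.mul (hx.aestronglyMeasurable_log hT)
    refine Integrable.mono' (((hx.integrable_control_sq i).add
      ((hD.comp_snd (volume.restrict (Set.Icc 0 G.T))).const_mul (Cκ ^ 2))).const_mul (Cr * 2)) hm ?_
    filter_upwards [ae_prod_restrict_Icc (hae.mono fun ω h => h.2.2.1)] with ⟨t, ω⟩ ⟨ht, h⟩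
    simp only at ht h
    rw [abs_of_nonneg (sq_nonneg _)] at h
    simp only [hR, feedback, Pi.add_apply, Real.norm_eq_abs]
    rw [abs_mul, abs_sq, mul_assoc Cr]
    refine mul_le_mul (hCr _ t ht) ?_ (sq_nonneg _) hCr0
    have h1 : (κ t (s t ω)) ^ 2 ≤ Cκ ^ 2 :=
      sq_le_sq' (neg_le_of_abs_le (hCκ _ t ht)) (le_of_abs_le (hCκ _ t ht))
    have h2 : κ t (s t ω) ^ 2 * Real.log (x t ω) ^ 2 ≤ Cκ ^ 2 * D ω :=
      mul_le_mul h1 h (sq_nonneg _) (sq_nonneg _)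
    have h3 : α i t (s t ω) * G.b₂ i t (s t ω) / G.r i t (s t ω) = κ t (s t ω) := rfl
    rw [h3]
    nlinarith [sq_nonneg (control γ x i t ω - κ t (s t ω) * Real.log (x t ω))]
  -- The Riccati equation is used here: its switching sum cancels the jump part of the generator,
  -- its sum over `j ≠ i` cancels the feedback of the others, and its term in `αᵢ²` completes the
  -- square in `uᵢ`.
  have halg : ∀ ω, ∀ t ∈ Set.Icc 0 G.T,
      G.q i t (s t ω) * Real.log (x t ω) ^ 2 + G.r i t (s t ω) * control γ x i t ω ^ 2
        = R t ω - L ω t := by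
    intro ω t ht
    have hr0 : G.r i t (s t ω) ≠ 0 := (hδ.trans (hr i t ht _)).ne'
    have hsum : ∑ j, G.b₂ j t (s t ω) * control γ x j t ω
        = G.b₂ i t (s t ω) * control γ x i t ω - Real.log (x t ω) *
          ∑ j ∈ Finset.univ.erase i, α j t (s t ω) * (G.b₂ j t (s t ω) ^ 2 / G.r j t (s t ω)) := by
      rw [← Finset.add_sum_erase _ _ (Finset.mem_univ i), sub_eq_add_neg, Finset.mul_sum,
        ← Finset.sum_neg_distrib]
      congr 1
      refine Finset.sum_congr rfl fun j hj => ?_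
      simp only [control, hγ j (Finset.ne_of_mem_erase hj), feedback]
      ring
    simp only [hR, hL, logDrift, feedback, riccatiRHS, hsum]
    field_simp
    ring
  have hcost : ∀ᵐ ω ∂μ, G.cost s i x (control γ x i) ω
      = α i G.T (s G.T ω) * Real.log (x G.T ω) ^ 2 + (∫ t in (0 : ℝ)..G.T, R t ω)
        - ∫ t in (0 : ℝ)..G.T, L ω t := by
    filter_upwards [hdyn.1, ae_intervalIntegrable_of_prod hT.le hRi] with ω h1 h2
    rw [add_sub_assoc, ← intervalIntegral.integral_sub h2 h1, cost, hα.terminal hT.le]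
    congr 1
    exact intervalIntegral.integral_congr fun t ht =>
      halg ω t (by rwa [Set.uIcc_of_le hT.le] at ht)
  have hV : ∀ t ∈ Set.Icc 0 G.T, Integrable (fun ω => α i t (s t ω) * Real.log (x t ω) ^ 2) μ := by
    intro t ht
    have h1 : Integrable (fun ω => Real.log (x t ω) ^ 2) μ :=
      hD.mono' (((hZm t ht).mono (ℱ.le t) le_rfl).aestronglyMeasurable)
        (hae.mono fun ω h => h.2.2.1 t ht)
    refine h1.bdd_mul (c := ∑ k, |α i t k|)
      ((hs.measurable_comp ht (α i t)).mono (ℱ.le t) le_rfl).aestronglyMeasurable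
      (Eventually.of_forall fun ω => ?_)
    exact Finset.single_le_sum (f := fun k => |α i t k|) (fun k _ => abs_nonneg _)
      (Finset.mem_univ (s t ω))
  have hRω := integrable_intervalIntegral_of_prod hT.le hRi
  have hVR : Integrable (fun ω => α i G.T (s G.T ω) * Real.log (x G.T ω) ^ 2
      + ∫ t in (0 : ℝ)..G.T, R t ω) μ := (hV _ hTT).add hRω
  have hLi : Integrable (fun ω => ∫ t in (0 : ℝ)..G.T, L ω t) μ := hdyn.2.1
  have hLeq : ∫ ω, (∫ t in (0 : ℝ)..G.T, L ω t) ∂μ = _ := hdyn.2.2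
  refine ⟨(hVR.sub hLi).congr (hcost.mono fun ω h => h.symm), ?_⟩
  rw [integral_congr_ae hcost, integral_sub hVR hLi,
    integral_add (hV _ hTT) hRω, hLeq, integral_sub (hV _ hTT) (hV _ h0T)]
  have h0 : ∫ ω, α i 0 (s 0 ω) * Real.log (x 0 ω) ^ 2 ∂μ
      = ∫ ω, α i 0 (s 0 ω) * Real.log G.x₀ ^ 2 ∂μ := by
    refine integral_congr_ae ?_
    filter_upwards [hx.ae_log_eq hT hcoeff hs] with ω h
    rw [h.1]
  rw [h0]
  ring

end LogSquareGame

/-! ### The feedback profile: its state and the equilibrium property. -/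

namespace LogSquareGame

variable {n m : ℕ} {G : LogSquareGame n m} {Ω : Type*} {mΩ : MeasurableSpace Ω} {μ : Measure Ω}
  {ℱ : Filtration ℝ mΩ} {s : ℝ → Ω → Fin m}

theorem isStrategy_feedback (hs : IsRegimeSwitching μ ℱ G.T G.rate s)
    (α : Fin n → ℝ → Fin m → ℝ) (i : Fin n) : IsStrategy ℱ G.T (G.feedback s α i) := by
  intro t ht
  have h1 : Measurable[(ℱ t).prod (borel ℝ)] fun p : Ω × ℝ =>
      -(α i t (s t p.1) * G.b₂ i t (s t p.1) / G.r i t (s t p.1)) :=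
    (hs.measurable_comp ht fun k => -(α i t k * G.b₂ i t k / G.r i t k)).comp
      (@measurable_fst _ _ (ℱ t) (borel ℝ))
  have h2 : Measurable[(ℱ t).prod (borel ℝ)] fun p : Ω × ℝ => Real.log p.2 :=
    Real.measurable_log.comp (@measurable_snd _ _ (ℱ t) (borel ℝ))
  exact h1.mul h2

/-- The rate of growth of the logarithm of the state under the feedback profile. -/
noncomputable def closedLoopRate (G : LogSquareGame n m) (α : Fin n → ℝ → Fin m → ℝ) (t : ℝ)
    (k : Fin m) : ℝ :=
  G.b₁ t k - ∑ j, G.b₂ j t k * (α j t k * G.b₂ j t k / G.r j t k)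

/-- Under the profile, `ln x` solves a scalar homogeneous linear equation, so `x = exp (ln x₀ · exp
I)` with `I` the integral of `closedLoopRate`. Since `I` is bounded, so are the controls, and
admissibility follows. -/
theorem exists_isState_feedback [IsProbabilityMeasure μ] (hT : 0 < G.T)
    (hx₀ : Real.exp 1 < G.x₀) (hcoeff : G.BddMeasurableCoeffs) {δ : ℝ} (hδ : 0 < δ)
    (hr : ∀ i, ∀ t ∈ Set.Icc 0 G.T, ∀ k, δ < G.r i t k)
    (hs : IsRegimeSwitching μ ℱ G.T G.rate s) {α : Fin n → ℝ → Fin m → ℝ}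
    (hα : G.IsRiccatiSolution α) : ∃ x, G.IsState μ ℱ s (G.feedback s α) x := by
  have hκ : ∀ j k, BddMeasurableOn G.T fun t => α j t k * G.b₂ j t k / G.r j t k := fun j k =>
    ((hα.bddMeasurableOn j k).mul (hcoeff.b₂ j k)).div (hcoeff.r j k) hδ fun t ht => hr j t ht k
  have hA : ∀ k, BddMeasurableOn G.T fun t => G.closedLoopRate α t k := fun k =>
    (hcoeff.b₁ k).sub (.finset_sum _ fun j _ => (hcoeff.b₂ j k).mul (hκ j k))
  obtain ⟨C, hC0, hC⟩ := exists_uniform_bound fun k => (hA k).2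
  have h0T : (0 : ℝ) ∈ Set.Icc 0 G.T := ⟨le_rfl, hT.le⟩
  set I : ℝ → Ω → ℝ := fun t ω => ∫ τ in (0 : ℝ)..t, G.closedLoopRate α τ (s τ ω) with hI
  have hAi := fun ω => hs.intervalIntegrable hT hA ω
  have hIeq : ∀ ω, ∀ t ∈ Set.Icc 0 G.T,
      I t ω = I 0 ω + ∫ τ in (0 : ℝ)..t, G.closedLoopRate α τ (s τ ω) := fun ω t _ => by simp [hI]
  have hIc : ∀ ω, ContinuousOn (fun t => I t ω) (Set.Icc 0 G.T) := fun ω =>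
    continuousOn_of_eq_add_integral hT.le (hAi ω) (hIeq ω)
  have hIm : ∀ t ∈ Set.Icc 0 G.T, Measurable[ℱ t] (I t) := fun t ht => hs.measurable_integral hA ht
  have hIle : ∀ ω, ∀ t ∈ Set.Icc 0 G.T, |I t ω| ≤ C * G.T := by
    intro ω t ht
    have h1 := intervalIntegral.norm_integral_le_of_norm_le_const (a := 0) (b := t) (C := C)
      (f := fun τ => G.closedLoopRate α τ (s τ ω)) fun τ hτ => by
        rw [Set.uIoc_of_le ht.1] at hτ
        exact hC _ τ ⟨hτ.1.le, hτ.2.trans ht.2⟩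
    rw [sub_zero, abs_of_nonneg ht.1] at h1
    exact h1.trans (mul_le_mul_of_nonneg_left ht.2 hC0)
  set c : ℝ := Real.log G.x₀ with hc
  have hx₀pos : 0 < G.x₀ := (Real.exp_pos 1).trans hx₀
  have hctrl : ∀ j t ω, control (G.feedback s α) (fun t ω => Real.exp (c * Real.exp (I t ω))) j t ω
      = -(α j t (s t ω) * G.b₂ j t (s t ω) / G.r j t (s t ω)) * (c * Real.exp (I t ω)) := by
    intro j t ω
    simp only [control, feedback, Real.log_exp]
  have hexpm : ∀ t ∈ Set.Icc 0 G.T, Measurable[ℱ t] fun ω => c * Real.exp (I t ω) := fun t ht =>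
    (Real.measurable_exp.comp (hIm t ht)).const_mul c
  refine ⟨fun t ω => Real.exp (c * Real.exp (I t ω)), fun j => ⟨fun t ht => ?_, ?_⟩,
    fun t ht => Real.measurable_exp.comp (hexpm t ht),
    Eventually.of_forall fun ω => ?_, Eventually.of_forall fun ω t _ => Real.exp_pos _,
    Eventually.of_forall fun ω t ht => ?_⟩
  · have h1 : control (G.feedback s α) (fun t ω => Real.exp (c * Real.exp (I t ω))) j t
        = fun ω => -(α j t (s t ω) * G.b₂ j t (s t ω) / G.r j t (s t ω)) * (c * Real.exp (I t ω)) :=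
      funext fun ω => hctrl j t ω
    rw [h1]
    exact (hs.measurable_comp ht fun k => -(α j t k * G.b₂ j t k / G.r j t k)).mul (hexpm t ht)
  · obtain ⟨Cκ, hCκ0, hCκ⟩ := exists_uniform_bound fun k => (hκ j k).2
    simp only [hctrl]
    refine MemLp.of_bound (C := Cκ * (|c| * Real.exp (C * G.T))) ?_ ?_
    · refine (hs.aestronglyMeasurable hT (fun k => (hκ j k).neg)).mul ?_
      refine aestronglyMeasurable_uncurry_of_right_continuous
        (f := fun t ω => c * Real.exp (I t ω)) hT
        (fun t ht => (hexpm t ht).mono (ℱ.le t) le_rfl) (Eventually.of_forall fun ω t ht => ?_)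
      have h1 := ((continuousOn_const (c := c)).mul (hIc ω).rexp) t (Set.Ico_subset_Icc_self ht)
      exact h1.tendsto.mono_left (nhdsWithin_le_of_mem (Icc_mem_nhdsGT_of_mem ht))
    · have h2 : ∀ᵐ ω ∂μ, ∀ t ∈ Set.Icc 0 G.T, |I t ω| ≤ C * G.T := Eventually.of_forall hIle
      filter_upwards [ae_prod_restrict_Icc h2] with p hp
      rw [norm_mul, norm_neg, norm_mul, Real.norm_eq_abs, Real.norm_eq_abs, Real.norm_eq_abs,
        abs_of_pos (Real.exp_pos _)]
      have h3 := hCκ (s p.1 p.2) p.1 hp.1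
      have h4 := Real.exp_le_exp.2 ((le_abs_self _).trans hp.2)
      gcongr
  · exact (continuousOn_const.mul (hIc ω).rexp).rexp
  · obtain ⟨K, hK⟩ := (isCompact_Icc (a := -(C * G.T)) (b := C * G.T)).exists_bound_of_continuousOn
      (f := fun z => Real.exp (c * Real.exp z) * (c * Real.exp z)) (by fun_prop)
    have key := comp_eq_add_integral (φ := fun z => Real.exp (c * Real.exp z))
      (φ' := fun z => Real.exp (c * Real.exp z) * (c * Real.exp z)) (K := K)
      (S := Set.Icc (-(C * G.T)) (C * G.T)) hT.le (convex_Icc _ _)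
      (fun z _ => ((Real.hasDerivAt_exp z).const_mul c).exp) hK
      (fun t ht => abs_le.1 (hIle ω t ht)) (hAi ω) (hIeq ω) t ht
    rw [key]
    congr 1
    · simp [hI, hc, Real.exp_log hx₀pos]
    · refine intervalIntegral.integral_congr fun τ _ => ?_
      simp only [hctrl, Real.log_exp, closedLoopRate, sub_eq_add_neg,
        ← Finset.sum_neg_distrib, mul_add, Finset.mul_sum]
      congr 1
      · ring
      · exact Finset.sum_congr rfl fun j _ => by ring

theorem isNashEquilibrium_feedback [IsProbabilityMeasure μ] (hT : 0 < G.T)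
    (hx₀ : Real.exp 1 < G.x₀) (hcoeff : G.BddMeasurableCoeffs) {δ : ℝ} (hδ : 0 < δ)
    (hr : ∀ i, ∀ t ∈ Set.Icc 0 G.T, ∀ k, δ < G.r i t k)
    (hs : IsRegimeSwitching μ ℱ G.T G.rate s) {α : Fin n → ℝ → Fin m → ℝ}
    (hα : G.IsRiccatiSolution α) :
    G.IsNashEquilibrium μ ℱ s (G.feedback s α) ∧
    ∀ x, G.IsState μ ℱ s (G.feedback s α) x → ∀ i,
      Integrable (G.cost s i x (control (G.feedback s α) x i)) μ ∧
      ∫ ω, G.cost s i x (control (G.feedback s α) x i) ω ∂μ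
        = ∫ ω, α i 0 (s 0 ω) * Real.log G.x₀ ^ 2 ∂μ := by
  have hopt : ∀ x, G.IsState μ ℱ s (G.feedback s α) x → ∀ i,
      Integrable (G.cost s i x (control (G.feedback s α) x i)) μ ∧
      ∫ ω, G.cost s i x (control (G.feedback s α) x i) ω ∂μ
        = ∫ ω, α i 0 (s 0 ω) * Real.log G.x₀ ^ 2 ∂μ := by
    intro x hx i
    obtain ⟨h1, h2⟩ := hx.integral_cost hT hcoeff hδ hr hs hα i fun j _ => rfl
    refine ⟨h1, h2.trans ?_⟩
    -- The control of player `i` is the feedback itself, so the squared deviation is zero.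
    simp [control]
  refine ⟨⟨isStrategy_feedback hs α, exists_isState_feedback hT hx₀ hcoeff hδ hr hs hα,
    fun x hx i v _ x' hx' => ?_⟩, hopt⟩
  rw [(hopt x hx i).2, (hx'.integral_cost hT hcoeff hδ hr hs hα i
    fun j hj => Function.update_of_ne hj _ _).2]
  refine le_add_of_nonneg_right (integral_nonneg fun ω => ?_)
  exact intervalIntegral.integral_nonneg hT.le fun t ht =>
    mul_nonneg (hδ.trans (hr i t ht _)).le (sq_nonneg _)

end LogSquareGame

theorem mainTheorem6 {n m : ℕ} (G : LogSquareGame n m)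
    (hT : 0 < G.T) (hx₀ : Real.exp 1 < G.x₀)
    (hcoeff : G.BddMeasurableCoeffs)
    (hq : ∀ i, ∀ t ∈ Set.Icc 0 G.T, ∀ k, 0 ≤ G.q i t k)
    (δ : ℝ) (hδ : 0 < δ) (hr : ∀ i, ∀ t ∈ Set.Icc 0 G.T, ∀ k, δ < G.r i t k)
    (hrate : ∀ t ∈ Set.Icc 0 G.T, ∀ k k', k ≠ k' → 0 < G.rate t k k')
    {Ω : Type*} {mΩ : MeasurableSpace Ω} (μ : Measure Ω) [IsProbabilityMeasure μ]
    (ℱ : Filtration ℝ mΩ) (s : ℝ → Ω → Fin m)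
    (hs : IsRegimeSwitching μ ℱ G.T G.rate s) :
    (∃ α, G.IsRiccatiSolution α) ∧
    ∀ α, G.IsRiccatiSolution α →
      G.IsNashEquilibrium μ ℱ s (G.feedback s α) ∧
      ∀ x, G.IsState μ ℱ s (G.feedback s α) x → ∀ i,
        Integrable (G.cost s i x (LogSquareGame.control (G.feedback s α) x i)) μ ∧
        ∫ ω, G.cost s i x (LogSquareGame.control (G.feedback s α) x i) ω ∂μ
          = ∫ ω, α i 0 (s 0 ω) * Real.log G.x₀ ^ 2 ∂μ :=
  ⟨LogSquareGame.exists_isRiccatiSolution hT hcoeff hq hδ hr hrate, fun _ hα =>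
    LogSquareGame.isNashEquilibrium_feedback hT hx₀ hcoeff hδ hr hs hα⟩
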